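/- Let $\Bbbk$ be an algebraically closed field, let $C$ be a commutative noetherian domain which is a $\Bbbk$-algebra, and let $I$ be a prime ideal of $C$. Let $G$ be a polycyclic-by-finite group acting on $C$ (on the left) by ring automorphisms; write $r^g$ for the image of $r\in C$ under $g\in G$, and $P^g=\{r^g : r\in P\}$ for an ideal $P$ of $C$. Let $B=C\# G$ be the skew group ring, that is, the free left $C$-module with basis $G$ and multiplication determined by $(rh)(sg)=(r\,s^h)(hg)$ for $r,s\in C$ and $g,h\in G$, and let $R=\{b\in B : b\,IB\subseteq IB\}$ be the idealiser in $B$ of the right ideal $IB$. Then the following are equivalent: 1. for every prime ideal $P$ of $C$, $\bigoplus_{g\in G}\operatorname{Tor}_1^C(C/I,\,C/P^g)\,g$ is a finitely generated left $R$-module; 2. $R$ is left noetherian. Here $R=\bigoplus_{h\in G}(I:I^h)\,h$ with $(I:I^h)=\{c\in C : cI^h\subseteq I\}$, and the left $R$-module structure on the direct sum is the natural one: for $c\in (I:I^h)$ and $x\in\operatorname{Tor}_1^C(C/I,C/P^g)$ one has $(ch)\cdot(x\,g)=(c\,x^h)\,(hg)$, where $x\mapsto c\,x^h$ is the map $\operatorname{Tor}_1^C(C/I,C/P^g)\to\operatorname{Tor}_1^C(C/I,C/P^{hg})$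 induced by the semilinear maps $C/I\to C/I$, $y\mapsto c\,y^h$, and $C/P^g\to C/P^{hg}$, $z\mapsto z^h$. -/

import Mathlib

open scoped TensorProduct Pointwise DirectSum

/-- A group is polycyclic if it has a finite subnormal series from the trivial subgroup to the
whole group all of whose factors are cyclic. -/
def IsPolycyclic (G : Type*) [Group G] : Prop :=
  ∃ (n : ℕ) (H : ℕ → Subgroup G), H 0 = ⊥ ∧ H n = ⊤ ∧
    ∀ i < n, H i ≤ H (i + 1) ∧
      ∃ _ : ((H i).subgroupOf (H (i + 1))).Normal,
        IsCyclic (↥(H (i + 1)) ⧸ (H i).subgroupOf (H (i + 1)))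

/-- A group is polycyclic-by-finite if it has a polycyclic normal subgroup of finite index. -/
def IsPolycyclicByFinite (G : Type*) [Group G] : Prop :=
  ∃ N : Subgroup G, N.Normal ∧ N.FiniteIndex ∧ IsPolycyclic N

noncomputable section

section Tor

/-! ### The first torsion module

`Tor₁ C M N` is the first left derived functor of `M ⊗[C] -` at `N`, computed from the canonical
free presentation `0 → K → F → N → 0`, where `F = (N →₀ C)` is free on the elements of `N`: since
the higher derived functors vanish on `F`, it is the kernel of `M ⊗ K → M ⊗ F`. -/

/-- The canonical surjection onto `N` from the free module on the elements of `N`. -/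
def freeCover (C N : Type*) [CommRing C] [AddCommGroup N] [Module C N] : (N →₀ C) →ₗ[C] N :=
  Finsupp.linearCombination C id

/-- The kernel of the canonical free cover of `N`. -/
abbrev FreeRel (C N : Type*) [CommRing C] [AddCommGroup N] [Module C N] :
    Submodule C (N →₀ C) :=
  LinearMap.ker (freeCover C N)

/-- `Tor_1^C(M, N)`. -/
def Tor₁ (C M N : Type*) [CommRing C] [AddCommGroup M] [Module C M]
    [AddCommGroup N] [Module C N] : Submodule C (M ⊗[C] FreeRel C N) :=
  LinearMap.ker (LinearMap.lTensor M (FreeRel C N).subtype)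

variable {C : Type*} [CommRing C] {σ : C →+* C}
  {M M' : Type*} [AddCommGroup M] [Module C M] [AddCommGroup M'] [Module C M']
  {N N' : Type*} [AddCommGroup N] [Module C N] [AddCommGroup N'] [Module C N']

/-- The map of canonical free covers induced by a semilinear map. -/
def freeMap (g : N →ₛₗ[σ] N') : (N →₀ C) →ₛₗ[σ] (N' →₀ C) where
  toFun x := (x.mapRange σ (map_zero σ)).mapDomain g
  map_add' x y := by
    rw [Finsupp.mapRange_add (fun a b => map_add σ a b), Finsupp.mapDomain_add]
  map_smul' c x := by
    have : (c • x).mapRange σ (map_zero σ) = σ c • x.mapRange σ (map_zero σ) := by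
      ext; simp
    rw [this, Finsupp.mapDomain_smul]

@[simp]
theorem freeMap_single (g : N →ₛₗ[σ] N') (n : N) (c : C) :
    freeMap g (Finsupp.single n c) = Finsupp.single (g n) (σ c) := by
  simp [freeMap]

theorem freeCover_freeMap (g : N →ₛₗ[σ] N') (x : N →₀ C) :
    freeCover C N' (freeMap g x) = g (freeCover C N x) := by
  induction x using Finsupp.induction_linear with
  | zero => simp
  | add x y hx hy => simp [hx, hy]
  | single n c => simp [freeCover]

/-- The map of kernels of the canonical free covers induced by a semilinear map. -/
def relMap (g : N →ₛₗ[σ] N') : FreeRel C N →ₛₗ[σ] FreeRel C N' where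
  toFun x := ⟨freeMap g x.1, by
    have := x.2
    rw [LinearMap.mem_ker] at this ⊢
    rw [freeCover_freeMap, this, map_zero]⟩
  map_add' x y := by ext1; simp
  map_smul' c x := by ext1; simp

theorem lTensor_map_relMap (f : M →ₛₗ[σ] M') (g : N →ₛₗ[σ] N') (x : M ⊗[C] FreeRel C N) :
    LinearMap.lTensor M' (FreeRel C N').subtype (TensorProduct.map f (relMap g) x) =
      TensorProduct.map f (freeMap g) (LinearMap.lTensor M (FreeRel C N).subtype x) := by
  induction x using TensorProduct.induction_on with
  | zero => simp
  | add x y hx hy => simp [hx, hy]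
  | tmul m n => rfl

/-- Functoriality of `Tor₁` in both variables, for a pair of maps which are semilinear over the
same ring homomorphism. -/
def tor₁Map (f : M →ₛₗ[σ] M') (g : N →ₛₗ[σ] N') : Tor₁ C M N →+ Tor₁ C M' N' where
  toFun x := ⟨TensorProduct.map f (relMap g) x.1, by
    have := x.2
    change _ = _ at this
    change _ = _
    rw [lTensor_map_relMap, this, map_zero]⟩
  map_zero' := by ext1; simp
  map_add' x y := by ext1; simp

end Tor

section Compare

open CategoryTheory

universe u

variable {C : Type u} [CommRing C]

theorem tor₁_aux {M N F F' : Type*} [AddCommGroup M] [Module C M] [AddCommGroup N] [Module C N]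
    [AddCommGroup F] [Module C F] [AddCommGroup F'] [Module C F']
    (p : F →ₗ[C] N) (p' : F' →ₗ[C] N) (a : F →ₗ[C] F') (b : F' →ₗ[C] F)
    (ha : p' ∘ₗ a = p) (hb : p ∘ₗ b = p')
    (a' : LinearMap.ker p →ₗ[C] LinearMap.ker p') (b' : LinearMap.ker p' →ₗ[C] LinearMap.ker p)
    (ha' : ∀ x, (a' x : F') = a x) (hb' : ∀ x, (b' x : F) = b x)
    (x : M ⊗[C] LinearMap.ker p) (hx : (LinearMap.ker p).subtype.lTensor M x = 0) :
    b'.lTensor M (a'.lTensor M x) = x := by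
  let u : F →ₗ[C] LinearMap.ker p := LinearMap.codRestrict _ (b ∘ₗ a - LinearMap.id) (fun y => by
    have h1 := LinearMap.congr_fun hb (a y)
    have h2 := LinearMap.congr_fun ha y
    simp only [LinearMap.comp_apply] at h1 h2
    simp [h1, h2])
  have hu : b' ∘ₗ a' = u ∘ₗ (LinearMap.ker p).subtype + LinearMap.id := by
    ext y
    simp [u, ha', hb']
  rw [← LinearMap.lTensor_comp_apply, hu, LinearMap.lTensor_add, LinearMap.add_apply,
    LinearMap.lTensor_comp_apply, hx]
  simp

/-- `Tor₁ C M N` may be computed from any projective presentation of `N`. -/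
theorem tor₁_presentation {M N F F' : Type*} [AddCommGroup M] [Module C M] [AddCommGroup N]
    [Module C N] [AddCommGroup F] [Module C F] [AddCommGroup F'] [Module C F']
    [Module.Projective C F] [Module.Projective C F']
    (p : F →ₗ[C] N) (p' : F' →ₗ[C] N) (hp : Function.Surjective p)
    (hp' : Function.Surjective p') :
    Nonempty (LinearMap.ker ((LinearMap.ker p).subtype.lTensor M) ≃ₗ[C]
      LinearMap.ker ((LinearMap.ker p').subtype.lTensor M)) := by
  obtain ⟨a, ha⟩ := Module.projective_lifting_property p' p hp'
  obtain ⟨b, hb⟩ := Module.projective_lifting_property p p' hp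
  let a' : LinearMap.ker p →ₗ[C] LinearMap.ker p' := a.restrict fun x hx => by
    rw [LinearMap.mem_ker] at *; rw [← LinearMap.comp_apply, ha, hx]
  let b' : LinearMap.ker p' →ₗ[C] LinearMap.ker p := b.restrict fun x hx => by
    rw [LinearMap.mem_ker] at *; rw [← LinearMap.comp_apply, hb, hx]
  have e1 : (LinearMap.ker p').subtype ∘ₗ a' = a ∘ₗ (LinearMap.ker p).subtype := rfl
  have e2 : (LinearMap.ker p).subtype ∘ₗ b' = b ∘ₗ (LinearMap.ker p').subtype := rfl
  refine ⟨LinearEquiv.ofLinearMap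
    ((a'.lTensor M).restrict fun x hx => ?_) ((b'.lTensor M).restrict fun x hx => ?_) ?_ ?_⟩
  · rw [LinearMap.mem_ker] at *
    rw [← LinearMap.lTensor_comp_apply, e1, LinearMap.lTensor_comp_apply, hx, map_zero]
  · rw [LinearMap.mem_ker] at *
    rw [← LinearMap.lTensor_comp_apply, e2, LinearMap.lTensor_comp_apply, hx, map_zero]
  · refine LinearMap.ext fun x => Subtype.ext ?_
    exact tor₁_aux p' p b a hb ha b' a' (fun _ => rfl) (fun _ => rfl) x.1 x.2
  · refine LinearMap.ext fun x => Subtype.ext ?_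
    exact tor₁_aux p p' a b ha hb a' b' (fun _ => rfl) (fun _ => rfl) x.1 x.2

theorem tor₁_complex {M N P₀ P₁ P₂ : Type*} [AddCommGroup M] [Module C M] [AddCommGroup N]
    [Module C N] [AddCommGroup P₀] [Module C P₀] [AddCommGroup P₁] [Module C P₁]
    [AddCommGroup P₂] [Module C P₂] [Module.Projective C P₀]
    (d₂ : P₂ →ₗ[C] P₁) (d₁ : P₁ →ₗ[C] P₀) (p : P₀ →ₗ[C] N)
    (h₁ : Function.Exact d₂ d₁) (h₀ : Function.Exact d₁ p) (hp : Function.Surjective p)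
    (f : M ⊗[C] P₂ →ₗ[C] LinearMap.ker (d₁.lTensor M))
    (hf : ∀ x, (f x : M ⊗[C] P₁) = d₂.lTensor M x) :
    Nonempty ((LinearMap.ker (d₁.lTensor M) ⧸ LinearMap.range f) ≃ₗ[C] Tor₁ C M N) := by
  obtain ⟨e⟩ := tor₁_presentation (M := M) p (freeCover C N) hp
    (fun n => ⟨Finsupp.single n 1, by simp [freeCover]⟩)
  let q : P₁ →ₗ[C] LinearMap.ker p := d₁.codRestrict _ fun x => (h₀ _).2 ⟨x, rfl⟩
  have hq : Function.Surjective q := fun y => by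
    obtain ⟨x, hx⟩ := (h₀ _).1 y.2
    exact ⟨x, Subtype.ext hx⟩
  have hd : (LinearMap.ker p).subtype ∘ₗ q = d₁ := rfl
  have hex : Function.Exact d₂ q := fun x => by
    rw [← h₁ x, ← Subtype.val_inj]; rfl
  have hex' := lTensor_exact M hex hq
  have hsurj := LinearMap.lTensor_surjective M hq
  let t : LinearMap.ker (d₁.lTensor M) →ₗ[C]
      LinearMap.ker ((LinearMap.ker p).subtype.lTensor M) := (q.lTensor M).restrict fun x hx => by
    rw [LinearMap.mem_ker] at *
    rwa [← LinearMap.lTensor_comp_apply, hd]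
  have ht : Function.Surjective t := fun y => by
    obtain ⟨x, hx⟩ := hsurj y.1
    refine ⟨⟨x, ?_⟩, Subtype.ext hx⟩
    rw [LinearMap.mem_ker, ← hd, LinearMap.lTensor_comp_apply, hx]
    exact y.2
  have hk : LinearMap.range f = LinearMap.ker t := by
    ext x
    rw [LinearMap.mem_ker, ← Subtype.val_inj]
    refine Iff.trans ?_ (hex' x.1).symm
    constructor
    · rintro ⟨y, rfl⟩; exact ⟨y, (hf y).symm⟩
    · rintro ⟨y, hy⟩; exact ⟨y, Subtype.ext ((hf y).trans hy)⟩
  exact ⟨(Submodule.quotEquivOfEq _ _ hk).trans ((t.quotKerEquivOfSurjective ht).trans e)⟩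

/-- `Tor₁ C M N` is isomorphic to Mathlib's `Tor`, defined through derived functors. -/
theorem tor₁_equiv_tor (M N : ModuleCat.{u} C) :
    Nonempty (((Tor (ModuleCat.{u} C) 1).obj M).obj N ≃ₗ[C] Tor₁ C M N) := by
  let P := projectiveResolution N
  let T := (MonoidalCategory.tensoringLeft (ModuleCat.{u} C)).obj M
  let K := (T.mapHomologicalComplex (ComplexShape.down ℕ)).obj P.complex
  let i₁ : ((Tor (ModuleCat.{u} C) 1).obj M).obj N ≅ K.homology 1 := P.isoLeftDerivedObj T 1
  let i₂ : K.homology 1 ≅ (K.sc' 2 1 0).homology :=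
    ShortComplex.homologyMapIso (K.isoSc' 2 1 0 (by simp) (by simp))
  let S := K.sc' 2 1 0
  let i₃ : (K.sc' 2 1 0).homology ≅ S.moduleCatLeftHomologyData.H := S.moduleCatHomologyIso
  have : Module.Projective C (P.complex.X 0) :=
    (IsProjective.iff_projective _).2 (P.projective 0)
  let π : P.complex.X 0 ⟶ N := P.π.f 0
  obtain ⟨e⟩ := tor₁_complex (M := M) (P.complex.d 2 1).hom (P.complex.d 1 0).hom π.hom
    ((ShortComplex.ShortExact.moduleCat_exact_iff_function_exact _).1 (P.exact_succ 0))
    ((ShortComplex.ShortExact.moduleCat_exact_iff_function_exact _).1 P.exact₀)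
    ((ModuleCat.epi_iff_surjective π).1 (inferInstanceAs (Epi (P.π.f 0))))
    S.moduleCatToCycles (fun _ => rfl)
  exact ⟨(i₁ ≪≫ i₂ ≪≫ i₃).toLinearEquiv.trans e⟩

end Compare

section Skew

variable {C : Type*} [CommRing C] {G : Type*} [Group G] [MulSemiringAction G C]

/-- For an ideal `I` of `C`, the right ideal `IB` of the skew group ring `B = C # G`. (In
`SkewMonoidAlgebra C G` the element `single g c` is `c g`, and `(c g)(d h) = (c (g • d)) (g h)`.) -/
def extIdeal (G : Type*) [Group G] [MulSemiringAction G C] (I : Ideal C) :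
    Submodule (SkewMonoidAlgebra C G)ᵐᵒᵖ (SkewMonoidAlgebra C G) :=
  Submodule.span _ ((fun c : C => SkewMonoidAlgebra.single (1 : G) c) '' (I : Set C))

/-- The idealiser `{b | b J ⊆ J}` of a right ideal `J` of a ring `B`. -/
def idealizer {B : Type*} [Ring B] (J : Submodule Bᵐᵒᵖ B) : Subring B where
  carrier := {b | ∀ x ∈ J, b * x ∈ J}
  mul_mem' {a b} ha hb x hx := by rw [mul_assoc]; exact ha _ (hb x hx)
  one_mem' x hx := by rwa [one_mul]
  add_mem' {a b} ha hb x hx := by rw [add_mul]; exact J.add_mem (ha x hx) (hb x hx)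
  zero_mem' x _ := by rw [zero_mul]; exact J.zero_mem
  neg_mem' {a} ha x hx := by rw [neg_mul]; exact J.neg_mem (ha x hx)

/-- The idealiser of `IB` in `B = C # G`. -/
abbrev skewIdealizer (G : Type*) [Group G] [MulSemiringAction G C] (I : Ideal C) :
    Subring (SkewMonoidAlgebra C G) :=
  idealizer (extIdeal G I)

/-- The ideal quotient `(I : I^h)`. -/
def colonAct (I : Ideal C) (h : G) : Ideal C where
  carrier := {c | ∀ i ∈ I, c * h • i ∈ I}
  add_mem' {a b} ha hb i hi := by rw [add_mul]; exact I.add_mem (ha i hi) (hb i hi)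
  zero_mem' i _ := by simp
  smul_mem' a b hb i hi := by
    rw [smul_eq_mul, mul_assoc]; exact I.mul_mem_left _ (hb i hi)

theorem coeff_mem_of_mem_extIdeal {I : Ideal C} {x : SkewMonoidAlgebra C G}
    (hx : x ∈ extIdeal G I) (h : G) : x.coeff h ∈ I := by
  classical
  induction hx using Submodule.span_induction generalizing h with
  | mem x hx =>
    obtain ⟨c, hc, rfl⟩ := hx
    simp only [SkewMonoidAlgebra.coeff_single_apply]
    split_ifs
    · exact hc
    · exact I.zero_mem
  | zero => simp
  | add x y _ _ hx hy => simpa using I.add_mem (hx h) (hy h)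
  | smul b x _ hx =>
    rw [← MulOpposite.op_unop b, op_smul_eq_mul, SkewMonoidAlgebra.coeff_mul,
      SkewMonoidAlgebra.sum_def']
    refine I.sum_mem fun k _ => ?_
    rw [SkewMonoidAlgebra.sum_def']
    refine I.sum_mem fun l _ => ?_
    split_ifs
    · exact I.mul_mem_right _ (hx k)
    · exact I.zero_mem

theorem coeff_mem_colonAct {I : Ideal C} {r : SkewMonoidAlgebra C G}
    (hr : r ∈ skewIdealizer G I) (h : G) : r.coeff h ∈ colonAct I h := by
  classical
  intro i hi
  have h1 := coeff_mem_of_mem_extIdeal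
    (hr (SkewMonoidAlgebra.single 1 i) (Submodule.subset_span ⟨i, hi, rfl⟩)) h
  rwa [SkewMonoidAlgebra.coeff_mul_single_aux (y := h) _ (by simp)] at h1

theorem single_mem_skewIdealizer {I : Ideal C} {h : G} {c : C} (hc : c ∈ colonAct I h) :
    SkewMonoidAlgebra.single h c ∈ skewIdealizer G I := by
  intro x hx
  induction hx using Submodule.span_induction with
  | mem x hx =>
    obtain ⟨i, hi, rfl⟩ := hx
    have : SkewMonoidAlgebra.single h c * SkewMonoidAlgebra.single (1 : G) i =
        MulOpposite.op (SkewMonoidAlgebra.single h (1 : C)) •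
          SkewMonoidAlgebra.single (1 : G) (c * h • i) := by
      rw [op_smul_eq_mul, SkewMonoidAlgebra.single_mul_single, SkewMonoidAlgebra.single_mul_single]
      simp
    show SkewMonoidAlgebra.single h c * SkewMonoidAlgebra.single (1 : G) i ∈ _
    rw [this]
    exact Submodule.smul_mem _ _ (Submodule.subset_span ⟨_, hc i hi, rfl⟩)
  | zero => rw [mul_zero]; exact Submodule.zero_mem _
  | add x y _ _ hx hy => rw [mul_add]; exact Submodule.add_mem _ hx hy
  | smul b x _ hx =>
    rw [← MulOpposite.op_unop b, op_smul_eq_mul, ← mul_assoc, ← op_smul_eq_mul]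
    exact Submodule.smul_mem _ _ hx

/-- The element `c h` of the idealiser, for `c ∈ (I : I^h)`. -/
def homog (I : Ideal C) (h : G) (c : colonAct I h) : skewIdealizer G I :=
  ⟨SkewMonoidAlgebra.single h c.1, single_mem_skewIdealizer c.2⟩

theorem skewIdealizer_induction {I : Ideal C} {p : skewIdealizer G I → Prop}
    (zero : p 0) (add : ∀ r s, p r → p s → p (r + s))
    (single : ∀ (h : G) (c : colonAct I h), p (homog I h c)) (r : skewIdealizer G I) : p r := by
  have : r = ∑ h ∈ r.1.support, homog I h ⟨r.1.coeff h, coeff_mem_colonAct r.2 h⟩ := by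
    ext1
    rw [AddSubmonoidClass.coe_finsetSum]
    conv_lhs => rw [← SkewMonoidAlgebra.sum_single r.1, SkewMonoidAlgebra.sum_def']
    rfl
  rw [this]
  exact Finset.sum_induction _ _ add zero fun h _ => single h _

open scoped Classical in
/-- The homogeneous components of an element of the idealiser. -/
def components (I : Ideal C) : skewIdealizer G I →+ ⨁ h : G, colonAct I h where
  toFun r := DFinsupp.mk r.1.support fun h => ⟨r.1.coeff h, coeff_mem_colonAct r.2 h⟩
  map_zero' := by
    refine DFinsupp.ext fun h => ?_
    rw [DFinsupp.mk_apply]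
    split_ifs <;> rfl
  map_add' r s := by
    refine DFinsupp.ext fun h => Subtype.ext ?_
    have key : ∀ t : skewIdealizer G I,
        ((DFinsupp.mk t.1.support fun h => ⟨t.1.coeff h, coeff_mem_colonAct t.2 h⟩ :
          Π₀ h : G, colonAct I h) h : C) = t.1.coeff h := by
      intro t
      rw [DFinsupp.mk_apply]
      split_ifs with ht
      · rfl
      · exact (SkewMonoidAlgebra.notMem_support_iff.1 ht).symm
    refine (key (r + s)).trans ?_
    rw [Subring.coe_add, SkewMonoidAlgebra.coeff_add, Finsupp.add_apply, ← key r, ← key s]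
    rfl

theorem coe_components (I : Ideal C) (r : skewIdealizer G I) (h : G) :
    (components I r h : C) = r.1.coeff h := by
  classical
  change ((DFinsupp.mk r.1.support fun h => ⟨r.1.coeff h, coeff_mem_colonAct r.2 h⟩ :
    Π₀ h : G, colonAct I h) h : C) = _
  rw [DFinsupp.mk_apply]
  split_ifs with ht
  · rfl
  · exact (SkewMonoidAlgebra.notMem_support_iff.1 ht).symm

theorem components_homog [DecidableEq G] (I : Ideal C) (h : G) (c : colonAct I h) :
    components I (homog I h c) = DirectSum.of (fun h : G => colonAct I h) h c := by
  refine DFinsupp.ext fun k => Subtype.ext ?_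
  refine (coe_components I _ k).trans ?_
  rw [homog, SkewMonoidAlgebra.coeff_single_apply]
  split_ifs with hk
  · subst hk
    exact congrArg Subtype.val (DirectSum.of_eq_same (β := fun h : G => colonAct I h) h c).symm
  · exact congrArg Subtype.val
      (DirectSum.of_eq_of_ne (β := fun h : G => colonAct I h) h k c (Ne.symm hk)).symm

/-- For `c ∈ (I : I^h)`, the map `x ↦ c x^h` from `C / I` to itself: the composite of
`C / I → C / I^h`, given by the action of `h`, and of multiplication by `c`. -/
def quotMul (I : Ideal C) (h : G) (c : colonAct I h) :
    (C ⧸ I) →ₛₗ[MulSemiringAction.toRingHom G C h] (C ⧸ I) :=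
  Submodule.mapQ I I
    { toFun := fun x => c.1 * h • x
      map_add' := fun x y => by rw [smul_add, mul_add]
      map_smul' := fun a x => by
        simp only [smul_eq_mul, smul_mul', MulSemiringAction.toRingHom_apply]; ring }
    (fun i hi => c.2 i hi)

/-- The map `C / P^g → C / P^(hg)` given by the action of `h`. -/
def quotShift (P : Ideal C) (h : G) {g g' : G} (hg : h * g = g') :
    (C ⧸ g • P) →ₛₗ[MulSemiringAction.toRingHom G C h] (C ⧸ g' • P) :=
  Submodule.mapQ (g • P) (g' • P)
    { toFun := fun x => h • x
      map_add' := fun x y => smul_add h x y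
      map_smul' := fun a x => smul_mul' h a x }
    (fun i hi => by
      subst hg; rw [mul_smul]; exact Ideal.smul_mem_pointwise_smul h i _ hi)

/-- The map `Tor_1(C / I, C / P^g) → Tor_1(C / I, C / P^(hg))` by which `c h` acts. -/
def torShift (I P : Ideal C) (h : G) (c : colonAct I h) {g g' : G} (hg : h * g = g') :
    Tor₁ C (C ⧸ I) (C ⧸ g • P) →+ Tor₁ C (C ⧸ I) (C ⧸ g' • P) :=
  tor₁Map (quotMul I h c) (quotShift P h hg)

/-- The direct sum over `g ∈ G` of the modules `Tor_1^C(C / I, C / P^g) g`. -/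
def TorSum (G : Type*) [Group G] [MulSemiringAction G C] (I P : Ideal C) : Type _ :=
  ⨁ g : G, Tor₁ C (C ⧸ I) (C ⧸ g • P)

instance (I P : Ideal C) : AddCommGroup (TorSum G I P) :=
  inferInstanceAs (AddCommGroup (⨁ g : G, Tor₁ C (C ⧸ I) (C ⧸ g • P)))

open scoped Classical in
/-- The element `x g` of the direct sum, for `x ∈ Tor_1^C(C / I, C / P^g)`. -/
def TorSum.of (I P : Ideal C) (g : G) : Tor₁ C (C ⧸ I) (C ⧸ g • P) →+ TorSum G I P :=
  DirectSum.of (fun g : G => Tor₁ C (C ⧸ I) (C ⧸ g • P)) g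

open scoped Classical in
/-- The action of the homogeneous element `c h`: it sends `x g` to `(c x^h) (h g)`. -/
def homogAct (I P : Ideal C) (h : G) (c : colonAct I h) : AddMonoid.End (TorSum G I P) :=
  DirectSum.toAddMonoid fun g => (TorSum.of I P (h * g)).comp (torShift I P h c rfl)

theorem TorSum.end_ext {I P : Ideal C} {φ ψ : AddMonoid.End (TorSum G I P)}
    (H : ∀ g x, φ (TorSum.of I P g x) = ψ (TorSum.of I P g x)) : φ = ψ := by
  classical
  exact DirectSum.addHom_ext (fun g x => H g x)

theorem homogAct_of (I P : Ideal C) (h : G) (c : colonAct I h) (g : G)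
    (x : Tor₁ C (C ⧸ I) (C ⧸ g • P)) :
    homogAct I P h c (TorSum.of I P g x) = TorSum.of I P (h * g) (torShift I P h c rfl x) := by
  classical
  exact DirectSum.toAddMonoid_of _ _ _

theorem of_torShift (I P : Ideal C) (h : G) (c : colonAct I h) {g g' : G} (hg : h * g = g')
    (x : Tor₁ C (C ⧸ I) (C ⧸ g • P)) :
    TorSum.of I P (h * g) (torShift I P h c rfl x) = TorSum.of I P g' (torShift I P h c hg x) := by
  subst hg; rfl

theorem relMap_comp {σ τ ρ : C →+* C} {N N' N'' : Type*} [AddCommGroup N] [Module C N]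
    [AddCommGroup N'] [Module C N'] [AddCommGroup N''] [Module C N'']
    (g : N →ₛₗ[σ] N') (g' : N' →ₛₗ[τ] N'') (g'' : N →ₛₗ[ρ] N'')
    (hσ : ∀ c, τ (σ c) = ρ c) (hg : ∀ n, g' (g n) = g'' n) (x : FreeRel C N) :
    relMap g' (relMap g x) = relMap g'' x := by
  ext1
  change freeMap g' (freeMap g x.1) = freeMap g'' x.1
  induction x.1 using Finsupp.induction_linear with
  | zero => simp
  | add x y hx hy => simp [hx, hy]
  | single n c => simp [hσ, hg]

theorem relMap_id {σ : C →+* C} {N : Type*} [AddCommGroup N] [Module C N]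
    (g : N →ₛₗ[σ] N) (hσ : ∀ c, σ c = c) (hg : ∀ n, g n = n) (x : FreeRel C N) :
    relMap g x = x := by
  ext1
  change freeMap g x.1 = x.1
  induction x.1 using Finsupp.induction_linear with
  | zero => simp
  | add x y hx hy => simp [hx, hy]
  | single n c => simp [hσ, hg]

theorem torShift_mul (I P : Ideal C) (h k : G) (c : colonAct I h) (d : colonAct I k)
    (e : colonAct I (h * k)) (he : e.1 = c.1 * h • d.1) {g g' g'' : G} (hg : k * g = g')
    (hg' : h * g' = g'') (hg'' : h * k * g = g'') (x : Tor₁ C (C ⧸ I) (C ⧸ g • P)) :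
    torShift I P h c hg' (torShift I P k d hg x) = torShift I P (h * k) e hg'' x := by
  ext1
  change TensorProduct.map _ _ (TensorProduct.map _ _ x.1) = TensorProduct.map _ _ x.1
  induction x.1 using TensorProduct.induction_on with
  | zero => simp
  | add x y hx hy => simp only [map_add, hx, hy]
  | tmul m n =>
    rw [TensorProduct.map_tmul, TensorProduct.map_tmul, TensorProduct.map_tmul]
    congr 1
    · obtain ⟨m, rfl⟩ := Submodule.Quotient.mk_surjective _ m
      change Submodule.Quotient.mk _ = Submodule.Quotient.mk _
      congr 1
      change c.1 * h • (d.1 * k • m) = e.1 * (h * k) • m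
      rw [he, smul_mul', mul_smul, mul_assoc]
    · refine relMap_comp _ _ _ (fun a => (mul_smul h k a).symm) (fun n => ?_) n
      obtain ⟨n, rfl⟩ := Submodule.Quotient.mk_surjective _ n
      change Submodule.Quotient.mk _ = Submodule.Quotient.mk _
      congr 1
      exact (mul_smul h k n).symm

theorem torShift_one (I P : Ideal C) (c : colonAct I (1 : G)) (hc : c.1 = 1) {g : G}
    (hg : 1 * g = g) (x : Tor₁ C (C ⧸ I) (C ⧸ g • P)) : torShift I P 1 c hg x = x := by
  ext1
  change TensorProduct.map _ _ x.1 = x.1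
  induction x.1 using TensorProduct.induction_on with
  | zero => simp
  | add x y hx hy => simp only [map_add, hx, hy]
  | tmul m n =>
    rw [TensorProduct.map_tmul]
    congr 1
    · obtain ⟨m, rfl⟩ := Submodule.Quotient.mk_surjective _ m
      change Submodule.Quotient.mk _ = Submodule.Quotient.mk _
      congr 1
      change c.1 * (1 : G) • m = m
      rw [hc, one_smul, one_mul]
    · refine relMap_id _ (fun a => one_smul G a) (fun n => ?_) n
      obtain ⟨n, rfl⟩ := Submodule.Quotient.mk_surjective _ n
      change Submodule.Quotient.mk _ = Submodule.Quotient.mk _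
      congr 1
      exact one_smul G n

theorem torShift_add (I P : Ideal C) (h : G) (c d : colonAct I h) {g g' : G} (hg : h * g = g')
    (x : Tor₁ C (C ⧸ I) (C ⧸ g • P)) :
    torShift I P h (c + d) hg x = torShift I P h c hg x + torShift I P h d hg x := by
  ext1
  change TensorProduct.map _ _ x.1 = TensorProduct.map _ _ x.1 + TensorProduct.map _ _ x.1
  rw [← LinearMap.add_apply, ← TensorProduct.map_add_left]
  congr 2
  refine LinearMap.ext fun m => ?_
  obtain ⟨m, rfl⟩ := Submodule.Quotient.mk_surjective _ m
  change Submodule.Quotient.mk _ = Submodule.Quotient.mk _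
  congr 1
  exact add_mul c.1 d.1 _

/-- `homogAct` as an additive map in the coefficient. -/
def homogActHom (I P : Ideal C) (h : G) : colonAct I h →+ AddMonoid.End (TorSum G I P) :=
  AddMonoidHom.mk' (homogAct I P h) fun c d => by
    refine TorSum.end_ext fun g x => ?_
    refine (homogAct_of I P h (c + d) g x).trans ?_
    rw [torShift_add, (TorSum.of I P (h * g)).map_add]
    exact (congrArg₂ (· + ·) (homogAct_of I P h c g x) (homogAct_of I P h d g x)).symm

open scoped Classical in
/-- The action of the idealiser on the direct sum, as an additive map. -/
def torActHom (I P : Ideal C) : skewIdealizer G I →+ AddMonoid.End (TorSum G I P) :=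
  (DirectSum.toAddMonoid (homogActHom I P)).comp (components I)

theorem torActHom_homog (I P : Ideal C) (h : G) (c : colonAct I h) :
    torActHom I P (homog I h c) = homogAct I P h c := by
  classical
  change DirectSum.toAddMonoid (homogActHom I P) (components I (homog I h c)) = _
  rw [components_homog]
  exact DirectSum.toAddMonoid_of _ _ _

/-- The action of the idealiser on the direct sum. -/
def torAct (I P : Ideal C) : skewIdealizer G I →+* AddMonoid.End (TorSum G I P) where
  toFun := torActHom I P
  map_zero' := map_zero _
  map_add' := map_add _
  map_one' := by
    have h1 : (1 : C) ∈ colonAct I (1 : G) := fun i hi => by simpa using hi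
    have : (1 : skewIdealizer G I) = homog I 1 ⟨1, h1⟩ := rfl
    rw [this, torActHom_homog]
    refine TorSum.end_ext fun g x => ?_
    change _ = TorSum.of I P g x
    rw [homogAct_of, of_torShift _ _ _ _ (one_mul g), torShift_one _ _ _ rfl]
  map_mul' r s := by
    induction r using skewIdealizer_induction with
    | zero => rw [zero_mul, map_zero, zero_mul]
    | add r r' hr hr' => rw [add_mul, map_add, map_add, add_mul, hr, hr']
    | single h c =>
      induction s using skewIdealizer_induction with
      | zero => rw [mul_zero, map_zero, mul_zero]
      | add s s' hs hs' => rw [mul_add, map_add, map_add, mul_add, hs, hs']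
      | single k d =>
        have hmem : c.1 * h • d.1 ∈ colonAct I (h * k) := by
          have := coeff_mem_colonAct (homog I h c * homog I k d).2 (h * k)
          simpa [homog, SkewMonoidAlgebra.single_mul_single] using this
        have : homog I h c * homog I k d = homog I (h * k) ⟨_, hmem⟩ := by
          ext1
          exact SkewMonoidAlgebra.single_mul_single ..
        rw [this, torActHom_homog, torActHom_homog, torActHom_homog]
        refine TorSum.end_ext fun g x => ?_
        refine (homogAct_of I P _ _ g x).trans (Eq.trans ?_
          (congrArg (homogAct I P h c) (homogAct_of I P k d g x)).symm)
        refine Eq.trans ?_ (homogAct_of I P h c _ _).symm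
        rw [of_torShift _ _ _ _ (mul_assoc h k g),
          torShift_mul I P h k c d ⟨_, hmem⟩ rfl rfl rfl (mul_assoc h k g)]

/-- The left module structure of `⨁ g, Tor_1^C(C / I, C / P^g) g` over the idealiser of `IB`. -/
instance (I P : Ideal C) : Module (skewIdealizer G I) (TorSum G I P) :=
  Module.compHom _ (torAct I P)

/-- The element `c h` of the idealiser acts by `(c h) (x g) = (c x^h) (h g)`. -/
theorem homog_smul_of (I P : Ideal C) (h : G) (c : colonAct I h) (g : G)
    (x : Tor₁ C (C ⧸ I) (C ⧸ g • P)) :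
    homog I h c • TorSum.of I P g x = TorSum.of I P (h * g) (torShift I P h c rfl x) :=
  (DFunLike.congr_fun (torActHom_homog I P h c) _).trans (homogAct_of I P h c g x)

end Skew

end

/-! Let S be the stabiliser of I in G. By primeness and the noetherian condition, (I:I^h) is C for h
∈ S and I for h ∉ S. Both sides of the equivalence amount to one condition (*): for every prime P, I
∩ P^g = I·P^g for all g outside finitely many right cosets Sf. Since Tor₁(C/I, C/P^g) = (I ∩
P^g)/(I·P^g), this is vanishing of Tor off finitely many cosets (`subsingleton_tor₁_iff`).

Finite generation ⇔ (*): elements ch with h ∉ S have c ∈ I and kill Tor, so R only moves degrees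
inside right cosets of S. There each s ∈ S acts invertibly, and every single Tor is finite over C
(`exists_cosetUnion_of_finite_torSum`, `finite_torSum_of_cosetUnion`).

Noetherian ⇒ (*): look at generators of the left ideal ⊕ (I ∩ P^g)g. In degrees off the cosets met
by their supports, they can only produce coefficients in I·P^g
(`exists_cosetUnion_of_isNoetherianRing`).

(*) ⇒ noetherian: a prime filtration extends (*) from primes to all ideals J. A graded left ideal N,
with J = Σ g⁻¹N_g, satisfies I·gJ ⊆ N_g ⊆ gJ, and N_g ⊆ I for g ∉ S. Once J has stabilised, (*)
fixes N_g off finitely many cosets, and in each remaining coset one N_g determines the others. This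
gives the chain condition on graded left ideals (`chainCondition_skewIdealizer`). A Hilbert basis
argument along the polycyclic series removes the grading (`isNoetherianRing_of_chainCondition`). -/

noncomputable section

/-! ### Uniform stabilisation of families of chains. -/

section ChainCondition

variable {α : Type*} [PartialOrder α]

/-- The ascending chain condition for a set `s` of elements of a partially ordered set. -/
def ChainCondition (s : Set α) : Prop :=
  ∀ f : ℕ →o α, (∀ i, f i ∈ s) → ∃ n, ∀ m, n ≤ m → f n = f m

theorem ChainCondition.finite {s : Set α} (hs : ChainCondition s) {κ : Type*} [Finite κ]
    (f : ℕ → κ → α) (hf : ∀ k, Monotone fun i => f i k) (hfs : ∀ i k, f i k ∈ s) :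
    ∃ n, ∀ m, n ≤ m → ∀ k, f n k = f m k := by
  choose n hn using fun k => hs ⟨fun i => f i k, hf k⟩ fun i => hfs i k
  obtain ⟨N, hN⟩ := (Set.finite_range n).bddAbove
  refine ⟨N, fun m hm k => ?_⟩
  have hk : n k ≤ N := hN ⟨k, rfl⟩
  exact (hn k N hk).symm.trans (hn k m (hk.trans hm))

/-- The diagonal stabilises at some p, which forces the whole quadrant beyond (p, p) to be constant;
only the finitely many columns k < p remain. -/
theorem ChainCondition.nat {s : Set α} (hs : ChainCondition s)
    (f : ℕ → ℕ → α) (hf : ∀ k, Monotone fun i => f i k) (hf' : ∀ i, Monotone (f i))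
    (hfs : ∀ i k, f i k ∈ s) :
    ∃ n, ∀ m, n ≤ m → ∀ k, f n k = f m k := by
  obtain ⟨p, hp⟩ := hs ⟨fun i => f i i, fun i j h => (hf i h).trans (hf' j h)⟩ fun i => hfs i i
  obtain ⟨n, hn⟩ := hs.finite (fun i (k : Fin p) => f i k) (fun k => hf k) fun i k => hfs i k
  have key : ∀ i k, p ≤ i → p ≤ k → f i k = f p p := fun i k hi hk =>
    le_antisymm (((hf k (le_max_left i k)).trans (hf' _ (le_max_right i k))).trans
      (hp (max i k) (hi.trans (le_max_left _ _))).ge) ((hf p hi).trans (hf' i hk))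
  refine ⟨max n p, fun m hm k => ?_⟩
  rcases lt_or_ge k p with hk | hk
  · exact (hn _ (le_max_left _ _) ⟨k, hk⟩).symm.trans
      (hn _ ((le_max_left _ _).trans hm) ⟨k, hk⟩)
  · rw [key _ k (le_max_right _ _) hk, key _ k ((le_max_right _ _).trans hm) hk]

end ChainCondition

namespace SkewMonoidAlgebra

/-! ### A Hilbert basis theorem for graded subrings of skew group rings. -/

section Graded

variable {C : Type*} [Ring C] {G : Type*}

theorem coeff_finsetSum {ι : Type*} (s : Finset ι) (f : ι → SkewMonoidAlgebra C G) (x : G) :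
    (∑ i ∈ s, f i).coeff x = ∑ i ∈ s, (f i).coeff x := by
  change coeffAddEquiv (∑ i ∈ s, f i) x = _
  rw [_root_.map_sum, Finsupp.finsetSum_apply]
  rfl

open scoped Classical in
/-- The part of an element which is supported on `S`. -/
def part (S : Set G) (x : SkewMonoidAlgebra C G) : SkewMonoidAlgebra C G :=
  ofCoeff (x.coeff.filter (· ∈ S))

open scoped Classical in
theorem coeff_part (S : Set G) (x : SkewMonoidAlgebra C G) (g : G) :
    (part S x).coeff g = if g ∈ S then x.coeff g else 0 :=
  Finsupp.filter_apply _ _ _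

theorem coeff_part_of_mem {S : Set G} (x : SkewMonoidAlgebra C G) {g : G} (hg : g ∈ S) :
    (part S x).coeff g = x.coeff g := by
  classical rw [coeff_part, if_pos hg]

theorem coeff_part_of_notMem {S : Set G} (x : SkewMonoidAlgebra C G) {g : G} (hg : g ∉ S) :
    (part S x).coeff g = 0 := by
  classical rw [coeff_part, if_neg hg]

variable [Group G]

/-- The left coset `gH`. -/
abbrev leftCoset (H : Subgroup G) (g : G) : Set G := {x | g⁻¹ * x ∈ H}

theorem mem_of_part_mem {A : Type*} [SetLike A (SkewMonoidAlgebra C G)]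
    [AddSubmonoidClass A (SkewMonoidAlgebra C G)] (N : A) (H : Subgroup G)
    {x : SkewMonoidAlgebra C G} (hx : ∀ g, part (leftCoset H g) x ∈ N) : x ∈ N := by
  classical
  have : x = ∑ q ∈ x.support.image (QuotientGroup.mk : G → G ⧸ H),
      part (leftCoset H q.out) x := by
    ext g
    rw [coeff_finsetSum]
    have key : ∀ q : G ⧸ H, g ∈ leftCoset H q.out ↔ q = QuotientGroup.mk g := fun q => by
      rw [Set.mem_ofPred_eq, ← QuotientGroup.eq, QuotientGroup.out_eq']
    by_cases hg : x.coeff g = 0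
    · rw [hg, Finset.sum_eq_zero]
      intro q _
      rw [coeff_part, hg, ite_self]
    · rw [Finset.sum_eq_single (QuotientGroup.mk g)]
      · rw [coeff_part_of_mem x ((key _).2 rfl)]
      · intro q _ hq
        exact coeff_part_of_notMem x fun h => hq ((key q).1 h)
      · intro h
        exact absurd (Finset.mem_image_of_mem _ (mem_support_iff.2 hg)) h
  rw [this]
  exact sum_mem fun q _ => hx q.out

variable [MulSemiringAction G C]

/-- A subring of a skew group ring is graded if it contains the homogeneous components of its
elements. -/
def IsGraded (A : Subring (SkewMonoidAlgebra C G)) : Prop :=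
  ∀ a ∈ A, ∀ g, single g (a.coeff g) ∈ A

variable {A : Subring (SkewMonoidAlgebra C G)}

theorem IsGraded.mem_iff (hA : IsGraded A) {x : SkewMonoidAlgebra C G} :
    x ∈ A ↔ ∀ g, single g (x.coeff g) ∈ A := by
  refine ⟨hA x, fun h => ?_⟩
  rw [← sum_single x, sum_def']
  exact sum_mem fun g _ => h g

variable (A) in
/-- The submodules `N` of a graded subring `A` which contain, for each element, its parts
supported on the left cosets of `H`. -/
def cosetGraded (H : Subgroup G) : Set (Submodule A (SkewMonoidAlgebra C G)) :=
  {N | (∀ n ∈ N, n ∈ A) ∧ ∀ n ∈ N, ∀ g, part (leftCoset H g) n ∈ N}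

/-- The elements whose part on each coset `gH` is the part on `gH` of an element of `N` supported
on `gF`. -/
def leading (hA : IsGraded A) (H : Subgroup G) (F : Set G)
    (N : Submodule A (SkewMonoidAlgebra C G)) : Submodule A (SkewMonoidAlgebra C G) where
  carrier := {m | ∀ g, ∃ n ∈ N, (∀ x, n.coeff x ≠ 0 → g⁻¹ * x ∈ F) ∧
    ∀ x, g⁻¹ * x ∈ H → n.coeff x = m.coeff x}
  zero_mem' g := ⟨0, N.zero_mem, fun x hx => absurd rfl hx, fun _ _ => rfl⟩
  add_mem' {m m'} hm hm' g := by
    obtain ⟨n, hn, h1, h2⟩ := hm g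
    obtain ⟨n', hn', h1', h2'⟩ := hm' g
    refine ⟨n + n', N.add_mem hn hn', fun x hx => ?_, fun x hx => ?_⟩
    · by_contra hF
      have e : n.coeff x = 0 := by_contra fun h => hF (h1 x h)
      have e' : n'.coeff x = 0 := by_contra fun h => hF (h1' x h)
      exact hx (by rw [coeff_add, Finsupp.add_apply, e, e', add_zero])
    · rw [coeff_add, coeff_add, Finsupp.add_apply, Finsupp.add_apply, h2 x hx, h2' x hx]
  smul_mem' a m hm := by
    -- Left multiplication by a homogeneous element of degree h carries a witness based at h⁻¹g to
    -- one based at g. As A is graded, such elements suffice.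
    have main : ∀ (h : G) (c : C), single h c ∈ A → ∀ g, ∃ n ∈ N,
        (∀ x, n.coeff x ≠ 0 → g⁻¹ * x ∈ F) ∧
          ∀ x, g⁻¹ * x ∈ H → n.coeff x = (single h c * m).coeff x := by
      intro h c hc g
      obtain ⟨n, hn, h1, h2⟩ := hm (h⁻¹ * g)
      refine ⟨single h c * n, N.smul_mem ⟨_, hc⟩ hn, fun x hx => ?_, fun x hx => ?_⟩
      · rw [coeff_single_mul] at hx
        have := h1 (h⁻¹ * x) fun h0 => hx (by rw [h0, smul_zero, mul_zero])
        simpa [mul_assoc] using this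
      · rw [coeff_single_mul, coeff_single_mul, h2]
        simpa [mul_assoc] using hx
    have e : a • m = ∑ h ∈ a.1.support, single h (a.1.coeff h) * m := by
      conv_lhs => rw [Subring.smul_def, smul_eq_mul, ← sum_single a.1, sum_def', Finset.sum_mul]
    intro g
    choose n hn h1 h2 using fun h => main h (a.1.coeff h) (hA a.1 a.2 h) g
    refine ⟨∑ h ∈ a.1.support, n h, N.sum_mem fun h _ => hn h, fun x hx => ?_, fun x hx => ?_⟩
    · rw [coeff_finsetSum] at hx
      obtain ⟨h, -, hh⟩ := Finset.exists_ne_zero_of_sum_ne_zero hx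
      exact h1 h x hh
    · rw [e, coeff_finsetSum, coeff_finsetSum]
      exact Finset.sum_congr rfl fun h _ => h2 h x hx

variable {H K : Subgroup G}

theorem leading_mono (hA : IsGraded A) (H : Subgroup G) {F F' : Set G} (hF : F ⊆ F')
    {N N' : Submodule A (SkewMonoidAlgebra C G)} (hN : N ≤ N') :
    leading hA H F N ≤ leading hA H F' N' := fun m hm g => by
  obtain ⟨n, hn, h1, h2⟩ := hm g
  exact ⟨n, hN hn, fun x hx => hF (h1 x hx), h2⟩

/-- Membership in `leading` is tested on each coset of H separately, so the result is graded by
H-cosets even when N is not. This is what brings the chain condition for H to bear on less graded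
submodules. -/
theorem leading_mem (hA : IsGraded A) (H : Subgroup G) (F : Set G)
    {N : Submodule A (SkewMonoidAlgebra C G)} (hN : ∀ n ∈ N, n ∈ A) :
    leading hA H F N ∈ cosetGraded A H := by
  refine ⟨fun m hm => hA.mem_iff.2 fun g => ?_, fun m hm g y => ?_⟩
  · obtain ⟨n, hn, -, h2⟩ := hm g
    rw [← h2 g (by rw [inv_mul_cancel]; exact H.one_mem)]
    exact hA n (hN n hn) g
  · obtain ⟨n, hn, h1, h2⟩ := hm y
    by_cases hy : g⁻¹ * y ∈ H
    · refine ⟨n, hn, h1, fun x hx => ?_⟩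
      rw [coeff_part_of_mem, h2 x hx]
      simpa [mul_assoc] using H.mul_mem hy hx
    · refine ⟨0, N.zero_mem, fun x hx => absurd rfl hx, fun x hx => ?_⟩
      rw [coeff_part_of_notMem]
      · rfl
      · intro hx'
        refine hy ?_
        simpa [mul_assoc] using H.mul_mem hx' (H.inv_mem hx)

/-- If `N` has the same leading parts as `N'`, then the leading part of an element of `N'` may be
removed by subtracting an element of `N`. -/
theorem exists_sub_of_leading_le (hA : IsGraded A) {F : Set G} (hF : ∀ h ∈ H, ∀ x ∈ F, h * x ∈ F)
    {N N' : Submodule A (SkewMonoidAlgebra C G)} (hN : N ≤ N')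
    (hle : leading hA H F N' ≤ leading hA H F N) {g : G} {n' : SkewMonoidAlgebra C G}
    (hn' : n' ∈ N') (hsupp : ∀ x, n'.coeff x ≠ 0 → g⁻¹ * x ∈ F) :
    ∃ n ∈ N, n' - n ∈ N' ∧ ∀ x, (n' - n).coeff x ≠ 0 → g⁻¹ * x ∈ F ∧ g⁻¹ * x ∉ H := by
  -- On the coset gH the witness is n' itself; changing the base point within gH keeps the support
  -- condition because HF ⊆ F. On other cosets the witness is 0.
  have hm : part (leftCoset H g) n' ∈ leading hA H F N' := by
    intro y
    by_cases hy : g⁻¹ * y ∈ H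
    · refine ⟨n', hn', fun x hx => ?_, fun x hx => ?_⟩
      · simpa [mul_assoc] using hF _ (H.inv_mem hy) _ (hsupp x hx)
      · rw [coeff_part_of_mem]
        simpa [mul_assoc] using H.mul_mem hy hx
    · refine ⟨0, N'.zero_mem, fun x hx => absurd rfl hx, fun x hx => ?_⟩
      rw [coeff_part_of_notMem]
      · rfl
      · intro hx'
        refine hy ?_
        simpa [mul_assoc] using H.mul_mem hx' (H.inv_mem hx)
  obtain ⟨n, hn, h1, h2⟩ := hle hm g
  refine ⟨n, hn, N'.sub_mem hn' (hN hn), fun x hx => ⟨?_, fun hxH => hx ?_⟩⟩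
  · by_contra hF'
    have e : n.coeff x = 0 := by_contra fun h => hF' (h1 x h)
    have e' : n'.coeff x = 0 := by_contra fun h => hF' (hsupp x h)
    exact hx (by rw [coeff_sub, Finsupp.sub_apply, e, e', sub_zero])
  · rw [coeff_sub, Finsupp.sub_apply, h2 x hxH, coeff_part_of_mem (S := leftCoset H g) _ hxH, sub_self]

/-- This is the Hilbert basis argument for skew Laurent polynomials in t: submodules are compared
through leading parts of elements of degree at most k, for all k at once. -/
theorem chainCondition_of_cyclic (hA : IsGraded A) (hn : ∀ k ∈ K, ∀ h ∈ H, k * h * k⁻¹ ∈ H)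
    (t : G) (ht : t ∈ K) (hcyc : ∀ x ∈ K, ∃ j : ℤ, t ^ j * x ∈ H)
    (hH : ChainCondition (cosetGraded A H)) : ChainCondition (cosetGraded A K) := by
  intro f hf
  -- The union of the cosets t⁻ʲH for 0 ≤ j ≤ k: the exponents available in degree at most k, with H
  -- itself as the leading position.
  let F : ℕ → Set G := fun k => {x | ∃ j ≤ k, t ^ j * x ∈ H}
  have hFmono : Monotone F := fun k l hkl x ⟨j, hj, hx⟩ => ⟨j, hj.trans hkl, hx⟩
  have hFH : ∀ k, ∀ h ∈ H, ∀ x ∈ F k, h * x ∈ F k := by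
    rintro k h hh x ⟨j, hj, hx⟩
    refine ⟨j, hj, ?_⟩
    simpa [mul_assoc] using H.mul_mem (hn (t ^ j) (K.pow_mem ht j) h hh) hx
  obtain ⟨p, hp⟩ := hH.nat (fun i k => leading hA H (F k) (f i))
    (fun k i j hij => leading_mono hA H le_rfl (f.monotone hij))
    (fun i k l hkl => leading_mono hA H (hFmono hkl) le_rfl)
    (fun i k => leading_mem hA H _ (hf i).1)
  refine ⟨p, fun m hm => le_antisymm (f.monotone hm) fun n hnm => ?_⟩
  have key : ∀ k g, ∀ n ∈ f m, (∀ x, n.coeff x ≠ 0 → g⁻¹ * x ∈ F k) → n ∈ f p := by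
    intro k
    induction k with
    | zero =>
      intro g n hn hsupp
      obtain ⟨n₀, hn₀, -, h2⟩ := exists_sub_of_leading_le hA (hFH 0) (f.monotone hm)
        (hp m hm 0).ge hn hsupp
      have : n - n₀ = 0 := by
        ext x
        by_contra h
        obtain ⟨⟨j, hj, hx⟩, hx'⟩ := h2 x h
        obtain rfl : j = 0 := by omega
        exact hx' (by simpa using hx)
      rwa [sub_eq_zero.1 this]
    | succ k ih =>
      intro g n hn hsupp
      obtain ⟨n₀, hn₀, h1, h2⟩ := exists_sub_of_leading_le hA (hFH (k + 1)) (f.monotone hm)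
        (hp m hm (k + 1)).ge hn hsupp
      -- With the part on gH gone, the support lies in the cosets g t⁻ʲH with 1 ≤ j ≤ k + 1, which
      -- is degree at most k based at g t⁻¹.
      have := ih (g * t⁻¹) (n - n₀) h1 fun x hx => by
        obtain ⟨⟨j, hj, hx⟩, hx'⟩ := h2 x hx
        rcases j with _ | j
        · exact absurd (by simpa using hx) hx'
        · refine ⟨j, by omega, ?_⟩
          simpa [pow_succ, mul_assoc] using hx
      simpa using (f p).add_mem this hn₀
  refine mem_of_part_mem (f p) K fun g => ?_
  choose! j hj using hcyc
  set n' := part (leftCoset K g) n with hn'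
  have hsupp : ∀ x, n'.coeff x ≠ 0 → g⁻¹ * x ∈ K := fun x hx =>
    by_contra fun h => hx (coeff_part_of_notMem n h)
  -- The exponents on the support lie in [-b, b]; rebasing at g tᵇ shifts them to [0, 2b], where the
  -- induction applies.
  obtain ⟨b, hb⟩ := (n'.support.finite_toSet.image fun x => |j (g⁻¹ * x)|).bddAbove
  have hb' : ∀ x, n'.coeff x ≠ 0 → |j (g⁻¹ * x)| ≤ b := fun x hx =>
    hb ⟨x, mem_support_iff.2 hx, rfl⟩
  refine key (2 * b).toNat (g * t ^ b) n' ((hf m).2 n hnm g) fun x hx => ?_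
  have h1 := abs_le.1 (hb' x hx)
  refine ⟨(j (g⁻¹ * x) + b).toNat, by omega, ?_⟩
  rw [← zpow_natCast, Int.toNat_of_nonneg (by omega), zpow_add]
  simpa [mul_assoc] using hj _ (hsupp x hx)

theorem chainCondition_of_finiteIndex (hA : IsGraded A) (H : Subgroup G) [H.Normal] [H.FiniteIndex]
    (hH : ChainCondition (cosetGraded A H)) : ChainCondition (cosetGraded A ⊤) := by
  classical
  intro f hf
  -- For k = (a, s), the translate of F k by a representative of a is the union of the cosets in s ∪
  -- {a}, and a is the coset to be cleared. There are finitely many such pairs, and the induction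
  -- below removes cosets from the support one by one.
  let F : (G ⧸ H) × Finset (G ⧸ H) → Set G := fun k =>
    {x | ((k.1.out * x : G) : G ⧸ H) ∈ insert k.1 k.2}
  have hFH : ∀ k, ∀ h ∈ H, ∀ x ∈ F k, h * x ∈ F k := by
    intro k h hh x hx
    have : ((k.1.out * (h * x) : G) : G ⧸ H) = ((k.1.out * x : G) : G ⧸ H) := by
      rw [QuotientGroup.mk_mul, QuotientGroup.mk_mul, QuotientGroup.mk_mul,
        (QuotientGroup.eq_one_iff h).2 hh, one_mul]
    rw [Set.mem_ofPred_eq, this]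
    exact hx
  have : Finite (G ⧸ H) := inferInstance
  have : Fintype (G ⧸ H) := Fintype.ofFinite _
  obtain ⟨p, hp⟩ := hH.finite (fun i k => leading hA H (F k) (f i))
    (fun k i j hij => leading_mono hA H le_rfl (f.monotone hij))
    (fun i k => leading_mem hA H _ (hf i).1)
  refine ⟨p, fun m hm => le_antisymm (f.monotone hm) fun n hnm => ?_⟩
  have key : ∀ s : Finset (G ⧸ H), ∀ n ∈ f m,
      (∀ x : G, n.coeff x ≠ 0 → (x : G ⧸ H) ∈ s) → n ∈ f p := by
    intro s
    induction s using Finset.induction_on with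
    | empty =>
      intro n hn hs
      have : n = 0 := by
        ext x
        by_contra h
        simpa using hs x h
      rw [this]
      exact (f p).zero_mem
    | insert a s ha ih =>
      intro n hn hs
      obtain ⟨n₀, hn₀, h1, h2⟩ := exists_sub_of_leading_le hA (g := a.out) (hFH (a, s))
        (f.monotone hm) (hp m hm (a, s)).ge hn fun x hx => by
          rw [Set.mem_ofPred_eq, mul_inv_cancel_left]
          exact hs x hx
      have := ih (n - n₀) h1 fun x hx => by
        obtain ⟨h3, h4⟩ := h2 x hx
        rw [← QuotientGroup.eq, QuotientGroup.out_eq'] at h4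
        have h5 : (x : G ⧸ H) ∈ insert a s := by
          rwa [Set.mem_ofPred_eq, mul_inv_cancel_left] at h3
        exact (Finset.mem_insert.1 h5).resolve_left fun h => h4 h.symm
      simpa using (f p).add_mem this hn₀
  exact key Finset.univ n hnm fun x _ => Finset.mem_univ _

/-- A subring of a skew group ring of a polycyclic-by-finite group which is graded and has the
ascending chain condition on graded left ideals is left noetherian. -/
theorem isNoetherianRing_of_chainCondition (hA : IsGraded A) (hG : IsPolycyclicByFinite G)
    (h : ChainCondition (cosetGraded A ⊥)) : IsNoetherianRing A := by
  obtain ⟨N, hN, hfin, n, H, h0, h1, hstep⟩ := hG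
  -- Climbing the series coarsens the grading, one cyclic factor at a time.
  have hind : ∀ i ≤ n, ChainCondition (cosetGraded A ((H i).map N.subtype)) := by
    intro i
    induction i with
    | zero => intro _; rwa [h0, Subgroup.map_bot]
    | succ i ih =>
      intro hi
      obtain ⟨hle, hnorm, hcyc⟩ := hstep i (by omega)
      obtain ⟨⟨q, ht⟩⟩ := hcyc
      obtain ⟨t, rfl⟩ := QuotientGroup.mk_surjective q
      refine chainCondition_of_cyclic hA ?_ (t.1.1 : G) ⟨t.1, t.2, rfl⟩ ?_
        (ih (by omega))
      · rintro _ ⟨k, hk, rfl⟩ _ ⟨h, hh, rfl⟩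
        exact ⟨k * h * k⁻¹, hnorm.conj_mem ⟨h, hle hh⟩ hh ⟨k, hk⟩, rfl⟩
      · rintro _ ⟨x, hx, rfl⟩
        obtain ⟨j, hj⟩ := ht (QuotientGroup.mk ⟨x, hx⟩)
        refine ⟨-j, t.1 ^ (-j) * x, ?_, by simp⟩
        have hj' : ((t ^ j : H (i + 1)) : ↥(H (i + 1)) ⧸ (H i).subgroupOf (H (i + 1))) =
          ((⟨x, hx⟩ : H (i + 1)) : _) := hj
        rw [QuotientGroup.eq, Subgroup.mem_subgroupOf] at hj'
        simpa using hj'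
  have hNN := hind n le_rfl
  rw [h1, ← MonoidHom.range_eq_map, Subgroup.range_subtype] at hNN
  have htop := chainCondition_of_finiteIndex hA N hNN
  let φ : A →ₗ[A] SkewMonoidAlgebra C G := (LinearMap.toSpanSingleton A _ 1)
  have hφ : ∀ a : A, φ a = a := fun a => by
    simp [φ, Subring.smul_def]
  have hφi : Function.Injective φ := fun a b hab => by
    rw [hφ, hφ] at hab; exact Subtype.ext hab
  rw [isNoetherianRing_iff, ← monotone_stabilizes_iff_noetherian]
  intro f
  obtain ⟨p, hp⟩ := htop ⟨fun i => (f i).map φ, fun i j hij => Submodule.map_mono (f.monotone hij)⟩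
    fun i => by
      refine ⟨?_, ?_⟩
      · rintro _ ⟨a, -, rfl⟩
        rw [hφ]; exact a.2
      -- All of G is a single coset, so being graded by cosets of ⊤ is no restriction.
      · intro x hx g
        have : part (leftCoset ⊤ g) x = x := by
          ext y
          exact coeff_part_of_mem x (Subgroup.mem_top _)
        rwa [this]
  exact ⟨p, fun m hm => Submodule.map_injective_of_injective hφi (hp m hm)⟩

end Graded

end SkewMonoidAlgebra

end

noncomputable section

/-! ### Vanishing of Tor₁ as the equality of I ∩ J and IJ. -/

section TorVanishing

variable {C : Type*} [CommRing C]

theorem mem_smul_top_iff (I J : Ideal C) (x : J) :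
    x ∈ I • (⊤ : Submodule C J) ↔ (x : C) ∈ I * J := by
  have : (I • (⊤ : Submodule C J)).map J.subtype = I * J := by
    rw [Submodule.map_smul'', Submodule.map_top, Submodule.range_subtype, smul_eq_mul]
  rw [← this]
  exact (J.subtype_injective.mem_set_image (s := ((I • ⊤ : Submodule C J) : Set J))).symm

/-- Under C/I ⊗ J ≅ J/IJ the map becomes J/IJ → C/I, whose kernel is (I ∩ J)/IJ. Every tensor here
has the form 1 ⊗ y. -/
theorem injective_lTensor_quotient_iff (I J : Ideal C) :
    LinearMap.ker (J.subtype.lTensor (C ⧸ I)) = ⊥ ↔ I ⊓ J ≤ I * J := by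
  have key : ∀ x : J, (1 : C ⧸ I) ⊗ₜ[C] x = 0 ↔ (x : C) ∈ I * J := fun x => by
    rw [← mem_smul_top_iff, ← Submodule.Quotient.mk_eq_zero,
      ← TensorProduct.quotTensorEquivQuotSMul_mk_one_tmul, LinearEquiv.map_eq_zero_iff]
  have key' : ∀ x : C, (1 : C ⧸ I) ⊗ₜ[C] x = 0 ↔ x ∈ I := fun x => by
    rw [← LinearEquiv.map_eq_zero_iff (TensorProduct.rid C (C ⧸ I)), TensorProduct.rid_tmul,
      ← Ideal.Quotient.eq_zero_iff_mem, ← Ideal.Quotient.mk_eq_mk, ← map_one (Ideal.Quotient.mk I),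
      ← Ideal.Quotient.mk_eq_mk, ← Submodule.Quotient.mk_smul, smul_eq_mul, mul_one]
  constructor
  · intro h x hx
    refine (key ⟨x, hx.2⟩).1 ?_
    rw [← Submodule.mem_bot C, ← h, LinearMap.mem_ker, LinearMap.lTensor_tmul]
    exact (key' x).2 hx.1
  · intro h
    rw [eq_bot_iff]
    intro x hx
    obtain ⟨y, rfl⟩ : ∃ y : J, (1 : C ⧸ I) ⊗ₜ[C] y = x := by
      obtain ⟨y, hy⟩ := Submodule.Quotient.mk_surjective _
        (TensorProduct.quotTensorEquivQuotSMul J I x)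
      refine ⟨y, (TensorProduct.quotTensorEquivQuotSMul J I).injective ?_⟩
      rw [TensorProduct.quotTensorEquivQuotSMul_mk_one_tmul, hy]
    rw [LinearMap.mem_ker, LinearMap.lTensor_tmul] at hx
    exact (key y).2 (h ⟨(key' _).1 hx, y.2⟩)

theorem exists_tor₁_equiv (M : Type*) [AddCommGroup M] [Module C M] (J : Ideal C) :
    Nonempty (LinearMap.ker (J.subtype.lTensor M) ≃ₗ[C] Tor₁ C M (C ⧸ J)) := by
  have h := tor₁_presentation (M := M) J.mkQ (freeCover C (C ⧸ J)) J.mkQ_surjective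
    (fun n => ⟨Finsupp.single n 1, by simp [freeCover]⟩)
  rwa [J.ker_mkQ] at h

theorem subsingleton_tor₁_iff (I J : Ideal C) :
    Subsingleton (Tor₁ C (C ⧸ I) (C ⧸ J)) ↔ I ⊓ J ≤ I * J := by
  obtain ⟨e⟩ := exists_tor₁_equiv (C ⧸ I) J
  rw [← injective_lTensor_quotient_iff, ← e.toEquiv.subsingleton_congr,
    Submodule.subsingleton_iff_eq_bot]

instance finite_tor₁ [IsNoetherianRing C] (M : Type*) [AddCommGroup M] [Module C M]
    [Module.Finite C M] (J : Ideal C) : Module.Finite C (Tor₁ C M (C ⧸ J)) := by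
  obtain ⟨e⟩ := exists_tor₁_equiv M J
  exact Module.Finite.equiv e

/-- The condition is symmetric in I and J, so Tor₁ can be tested by resolving C/I instead of C/J. In
this form C/J can be replaced by an arbitrary module. -/
theorem injective_rTensor_quotient_iff (I J : Ideal C) :
    Function.Injective (I.subtype.rTensor (C ⧸ J)) ↔ I ⊓ J ≤ I * J := by
  have e : LinearMap.ker (I.subtype.rTensor (C ⧸ J)) = ⊥ ↔
      LinearMap.ker (I.subtype.lTensor (C ⧸ J)) = ⊥ := by
    rw [LinearMap.ker_eq_bot, LinearMap.ker_eq_bot, LinearMap.lTensor_inj_iff_rTensor_inj]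
  rw [← LinearMap.ker_eq_bot, e, injective_lTensor_quotient_iff, inf_comm, mul_comm]

/-- Injectivity here means Tor₁(C/I, N) = 0, so this is the middle term of the long exact sequence.
The diagram chase uses flatness of C to keep C ⊗ N₁ → C ⊗ N₂ injective. -/
theorem injective_rTensor_of_exact (I : Ideal C) {N₁ N₂ N₃ : Type*} [AddCommGroup N₁]
    [Module C N₁] [AddCommGroup N₂] [Module C N₂] [AddCommGroup N₃] [Module C N₃]
    (f : N₁ →ₗ[C] N₂) (g : N₂ →ₗ[C] N₃) (hf : Function.Injective f)
    (hg : Function.Surjective g) (hfg : Function.Exact f g)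
    (h₁ : Function.Injective (I.subtype.rTensor N₁))
    (h₃ : Function.Injective (I.subtype.rTensor N₃)) :
    Function.Injective (I.subtype.rTensor N₂) := by
  rw [injective_iff_map_eq_zero] at h₁ h₃ ⊢
  intro x hx
  have hx3 : g.lTensor I x = 0 := h₃ _ (by
    rw [← LinearMap.comp_apply, LinearMap.rTensor_comp_lTensor, ← LinearMap.lTensor_comp_rTensor,
      LinearMap.comp_apply, hx, map_zero])
  obtain ⟨y, rfl⟩ := (lTensor_exact I hfg hg x).1 hx3
  rw [h₁ y, map_zero]
  refine Module.Flat.lTensor_preserves_injective_linearMap (M := C) f hf ?_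
  rw [map_zero, ← LinearMap.comp_apply, LinearMap.lTensor_comp_rTensor,
    ← LinearMap.rTensor_comp_lTensor, LinearMap.comp_apply, hx]

end TorVanishing

/-! ### Exceptional cosets of the stabiliser, and the ideals (I : I^h). -/

section Cosets

variable {G : Type*} [Group G]

/-- The union of the right cosets `Sf` with `f ∈ F`. -/
def cosetUnion (S : Subgroup G) (F : Finset G) : Set G :=
  {g | ∃ f ∈ F, g * f⁻¹ ∈ S}

theorem mul_mem_cosetUnion {S : Subgroup G} {F : Finset G} {s g : G} (hs : s ∈ S) :
    s * g ∈ cosetUnion S F ↔ g ∈ cosetUnion S F := by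
  simp only [cosetUnion, Set.mem_ofPred_eq, mul_assoc, S.mul_mem_cancel_left hs]

theorem cosetUnion_mono {S : Subgroup G} {F F' : Finset G} (h : F ⊆ F') :
    cosetUnion S F ⊆ cosetUnion S F' := fun _ ⟨f, hf, hg⟩ => ⟨f, h hf, hg⟩

theorem subset_cosetUnion (S : Subgroup G) (F : Finset G) : (F : Set G) ⊆ cosetUnion S F :=
  fun f hf => ⟨f, hf, by rw [mul_inv_cancel]; exact S.one_mem⟩

variable {C : Type*} [CommRing C] [MulSemiringAction G C]

/-- Apply the automorphism g⁻¹. The varying g moves from J to I, so one filtration of the fixed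
module C/J serves all g. -/
theorem inf_smul_le_iff (I J : Ideal C) (g : G) :
    I ⊓ g • J ≤ I * g • J ↔ (g⁻¹ • I) ⊓ J ≤ (g⁻¹ • I) * J := by
  have h1 : g⁻¹ • I ⊓ J = g⁻¹ • (I ⊓ g • J) := by
    ext x
    simp only [Submodule.mem_inf, Ideal.mem_inv_pointwise_smul_iff,
      Ideal.smul_mem_pointwise_smul_iff]
  have h2 : g⁻¹ • I * J = g⁻¹ • (I * g • J) := by
    rw [smul_mul', inv_smul_smul]
  rw [h1, h2, Ideal.pointwise_smul_le_pointwise_smul_iff]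

/-- Induction along a filtration with factors C/P, P prime: an extension is exceptional at most on
the union of the two exceptional sets. -/
theorem exists_cosetUnion_of_finite [IsNoetherianRing C] (S : Subgroup G) (I : Ideal C)
    (h : ∀ P : Ideal C, P.IsPrime → ∃ F, ∀ g ∉ cosetUnion S F,
      Function.Injective ((g⁻¹ • I).subtype.rTensor (C ⧸ P)))
    (M : Type*) [AddCommGroup M] [Module C M] [hM : Module.Finite C M] :
    ∃ F, ∀ g ∉ cosetUnion S F, Function.Injective ((g⁻¹ • I).subtype.rTensor M) := by
  classical
  induction hM using
    IsNoetherianRing.induction_on_isQuotientEquivQuotientPrime C with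
  | subsingleton N => exact ⟨∅, fun g _ => Function.injective_of_subsingleton _⟩
  | quotient N p e =>
    obtain ⟨F, hF⟩ := h p.1 p.2
    refine ⟨F, fun g hg => ?_⟩
    have := Function.Injective.comp (hF g hg) (e.lTensor (g⁻¹ • I : Ideal C)).injective
    refine Function.Injective.of_comp (f := e.lTensor C) ?_
    convert this using 1
    ext x
    exact LinearMap.congr_fun ((LinearMap.lTensor_comp_rTensor (g := e.toLinearMap) ..).trans
      (LinearMap.rTensor_comp_lTensor ..).symm) x
  | exact N₁ N₂ N₃ f g hf hg hfg h₁ h₃ =>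
    obtain ⟨F₁, hF₁⟩ := h₁
    obtain ⟨F₃, hF₃⟩ := h₃
    refine ⟨F₁ ∪ F₃, fun x hx => injective_rTensor_of_exact _ f g hf hg hfg
      (hF₁ x fun hx' => hx (cosetUnion_mono Finset.subset_union_left hx'))
      (hF₃ x fun hx' => hx (cosetUnion_mono Finset.subset_union_right hx'))⟩

theorem exists_cosetUnion_of_prime [IsNoetherianRing C] (S : Subgroup G) (I : Ideal C)
    (h : ∀ P : Ideal C, P.IsPrime → ∃ F, ∀ g ∉ cosetUnion S F, I ⊓ g • P ≤ I * g • P)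
    (J : Ideal C) : ∃ F, ∀ g ∉ cosetUnion S F, I ⊓ g • J ≤ I * g • J := by
  simp only [inf_smul_le_iff] at h ⊢
  simp only [← injective_rTensor_quotient_iff] at h ⊢
  exact exists_cosetUnion_of_finite S I h (C ⧸ J)

/-- The ascending chain I ⊆ h⁻¹I ⊆ h⁻²I ⊆ … stabilises; cancelling a power of h⁻¹ gives I = h⁻¹I. -/
theorem mem_stabilizer_of_smul_le [IsNoetherianRing C] {I : Ideal C} {h : G} (hI : h • I ≤ I) :
    h ∈ MulAction.stabilizer G I := by
  have hmono : Monotone fun n : ℕ => (h⁻¹) ^ n • I := monotone_nat_of_le_succ fun n => by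
    rw [pow_succ, mul_smul, Ideal.pointwise_smul_le_pointwise_smul_iff]
    rwa [← Ideal.pointwise_smul_subset_iff]
  obtain ⟨n, hn⟩ := monotone_stabilizes_iff_noetherian.2 ‹IsNoetherianRing C› ⟨_, hmono⟩
  have := hn (n + 1) n.le_succ
  simp only [OrderHom.coe_mk, pow_succ, mul_smul, smul_left_cancel_iff] at this
  rw [MulAction.mem_stabilizer_iff]
  conv_lhs => rw [this]
  exact smul_inv_smul h I

theorem le_colonAct (I : Ideal C) (h : G) : I ≤ colonAct I h :=
  fun _ hc _ _ => I.mul_mem_right _ hc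

theorem one_mem_colonAct {I : Ideal C} {s : G} (hs : s ∈ MulAction.stabilizer G I) :
    1 ∈ colonAct I s := fun i hi => by
  rw [one_mul]
  have := Ideal.smul_mem_pointwise_smul s i I hi
  rwa [MulAction.mem_stabilizer_iff.1 hs] at this

/-- If c ∉ I, primeness turns c·I^h ⊆ I into I^h ⊆ I, and then h stabilises I. -/
theorem mem_of_mem_colonAct [IsNoetherianRing C] {I : Ideal C} (hI : I.IsPrime) {h : G}
    (hh : h ∉ MulAction.stabilizer G I) {c : C} (hc : c ∈ colonAct I h) : c ∈ I := by
  by_contra hcI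
  refine hh (mem_stabilizer_of_smul_le fun x hx => ?_)
  rw [Ideal.mem_pointwise_smul_iff_inv_smul_mem] at hx
  have := hc _ hx
  rw [smul_inv_smul] at this
  exact (hI.mem_or_mem this).resolve_left hcI

end Cosets

end

noncomputable section

/-! ### Graded left ideals of the idealiser and the noetherian property. -/

section Idealizer

open SkewMonoidAlgebra

variable {C : Type*} [CommRing C] {G : Type*} [Group G] [MulSemiringAction G C]

theorem isGraded_skewIdealizer (I : Ideal C) : IsGraded (skewIdealizer G I) :=
  fun _ ha g => single_mem_skewIdealizer (coeff_mem_colonAct ha g)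

/-- The coefficients of the elements of `N` of degree `g`. -/
def homogComponent {I : Ideal C} (N : Submodule (skewIdealizer G I) (SkewMonoidAlgebra C G))
    (g : G) : Ideal C where
  carrier := {c | single g c ∈ N}
  zero_mem' := by simp
  add_mem' {a b} ha hb := by
    rw [Set.mem_ofPred_eq, single_add]
    exact N.add_mem ha hb
  smul_mem' c x hx := by
    have := N.smul_mem (homog I 1 ⟨c, fun i hi => I.mul_mem_left c (by rwa [one_smul])⟩) hx
    rwa [Subring.smul_def, smul_eq_mul, homog, single_mul_single, one_mul, one_smul] at this

variable {I : Ideal C} {N : Submodule (skewIdealizer G I) (SkewMonoidAlgebra C G)}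

theorem homogComponent_mono {N' : Submodule (skewIdealizer G I) (SkewMonoidAlgebra C G)}
    (h : N ≤ N') (g : G) : homogComponent N g ≤ homogComponent N' g := fun _ hx => h hx

theorem mul_smul_mem_homogComponent {h : G} {c : C} (hc : c ∈ colonAct I h) {g : G} {x : C}
    (hx : x ∈ homogComponent N g) : c * h • x ∈ homogComponent N (h * g) := by
  have := N.smul_mem (homog I h ⟨c, hc⟩) hx
  rwa [Subring.smul_def, smul_eq_mul, homog, single_mul_single] at this

/-- Both s and s⁻¹ lie in the idealiser. Hence one component determines all those in its right coset
of the stabiliser. -/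
theorem homogComponent_smul {s : G} (hs : s ∈ MulAction.stabilizer G I) (g : G) :
    homogComponent N (s * g) = s • homogComponent N g := by
  ext x
  rw [Ideal.mem_pointwise_smul_iff_inv_smul_mem]
  constructor
  · intro hx
    simpa using mul_smul_mem_homogComponent (one_mem_colonAct (inv_mem hs)) hx
  · intro hx
    simpa using mul_smul_mem_homogComponent (one_mem_colonAct hs) hx

theorem coeff_mem_homogComponent (hN : N ∈ cosetGraded (skewIdealizer G I) ⊥)
    {n : SkewMonoidAlgebra C G} (hn : n ∈ N) (g : G) : n.coeff g ∈ homogComponent N g := by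
  classical
  have : part (leftCoset ⊥ g) n = single g (n.coeff g) := by
    ext x
    rw [coeff_part, coeff_single_apply]
    simp only [Set.mem_ofPred_eq, Subgroup.mem_bot, inv_mul_eq_one]
    split_ifs with h
    · rw [h]
    · rfl
  have h := hN.2 n hn g
  rwa [this] at h

theorem le_of_homogComponent_le {N' : Submodule (skewIdealizer G I) (SkewMonoidAlgebra C G)}
    (hN : N ∈ cosetGraded (skewIdealizer G I) ⊥)
    (h : ∀ g, homogComponent N g ≤ homogComponent N' g) : N ≤ N' := fun n hn => by
  rw [← sum_single n, sum_def']
  exact N'.sum_mem fun g _ => h g (coeff_mem_homogComponent hN hn g)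

/-- The degree `1` coefficients of the left ideal of the skew group ring generated by `N`. -/
def extComponent (N : Submodule (skewIdealizer G I) (SkewMonoidAlgebra C G)) : Ideal C :=
  ⨆ g : G, g⁻¹ • homogComponent N g

theorem homogComponent_le_smul_extComponent (g : G) : homogComponent N g ≤ g • extComponent N := by
  rw [Ideal.subset_pointwise_smul_iff]
  exact le_iSup (fun g : G => g⁻¹ • homogComponent N g) g

/-- For i ∈ I the element i·(gh⁻¹) is in the idealiser for every h, and it moves degree h to degree
g. The ideal T below reduces the claim to the summands h⁻¹N_h. -/
theorem mul_smul_extComponent_le (g : G) : I * g • extComponent N ≤ homogComponent N g := by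
  let T : Ideal C :=
    { carrier := {k | ∀ i ∈ I, i * g • k ∈ homogComponent N g}
      zero_mem' := fun i _ => by simp
      add_mem' := fun {a b} ha hb i hi => by
        rw [smul_add, mul_add]
        exact add_mem (ha i hi) (hb i hi)
      smul_mem' := fun c x hx i hi => by
        rw [smul_eq_mul, smul_mul', mul_left_comm]
        exact Ideal.mul_mem_left _ _ (hx i hi) }
  have hT : extComponent N ≤ T := iSup_le fun h x hx i hi => by
    rw [Ideal.mem_inv_pointwise_smul_iff] at hx
    have := mul_smul_mem_homogComponent (le_colonAct I (g * h⁻¹) hi) hx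
    rwa [inv_mul_cancel_right, ← mul_smul, inv_mul_cancel_right] at this
  refine Ideal.mul_le.2 fun i hi x hx => ?_
  rw [Ideal.mem_pointwise_smul_iff_inv_smul_mem] at hx
  simpa using hT hx i hi

variable [IsNoetherianRing C]

theorem chainCondition_skewIdealizer (hI : I.IsPrime)
    (h : ∀ P : Ideal C, P.IsPrime →
      ∃ F, ∀ g ∉ cosetUnion (MulAction.stabilizer G I) F, I ⊓ g • P ≤ I * g • P) :
    ChainCondition (cosetGraded (skewIdealizer G I) ⊥) := by
  classical
  intro f hf
  have hmono : Monotone fun i => extComponent (f i) := fun i j hij =>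
    iSup_mono fun g => smul_mono_right _ (homogComponent_mono (f.monotone hij) g)
  obtain ⟨p, hp⟩ := monotone_stabilizes_iff_noetherian.2 ‹IsNoetherianRing C› ⟨_, hmono⟩
  replace hp : ∀ m, p ≤ m → extComponent (f p) = extComponent (f m) := hp
  obtain ⟨F, hF⟩ := exists_cosetUnion_of_prime _ I h (extComponent (f p))
  choose n hn using fun g => monotone_stabilizes_iff_noetherian.2 ‹IsNoetherianRing C›
    ⟨fun i => homogComponent (f i) g, fun i j hij => homogComponent_mono (f.monotone hij) g⟩
  replace hn : ∀ g m, n g ≤ m → homogComponent (f (n g)) g = homogComponent (f m) g := hn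
  -- Adding 1 makes the stabiliser itself an exceptional coset, so that every remaining degree g has
  -- N_g ⊆ I.
  let F' := insert 1 F
  refine ⟨max p (F'.sup n), fun m hm => le_antisymm (f.monotone hm) ?_⟩
  set q := max p (F'.sup n) with hq
  have hpq : p ≤ q := le_max_left _ _
  refine le_of_homogComponent_le (hf m) fun g => ?_
  by_cases hg : g ∈ cosetUnion (MulAction.stabilizer G I) F'
  · obtain ⟨x, hx, hs⟩ := hg
    have hxq : n x ≤ q := (Finset.le_sup hx).trans (le_max_right _ _)
    rw [← inv_mul_cancel_right g x, homogComponent_smul hs, homogComponent_smul hs,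
      ← hn x q hxq, ← hn x m (hxq.trans hm)]
  · have hgF := hF g fun hg' => hg (cosetUnion_mono (Finset.subset_insert _ _) hg')
    have hgS : g ∉ MulAction.stabilizer G I := fun hs =>
      hg ⟨1, Finset.mem_insert_self _ _, by simpa using hs⟩
    have h1 : homogComponent (f m) g ≤ I := fun c hc => by
      have := coeff_mem_colonAct ((hf m).1 _ hc) g
      rw [coeff_single_apply, if_pos rfl] at this
      exact mem_of_mem_colonAct hI hgS this
    have h2 : homogComponent (f m) g ≤ g • extComponent (f p) := by
      rw [hp m (hpq.trans hm)]
      exact homogComponent_le_smul_extComponent g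
    -- The sandwich closes: the later component lies in I ∩ gJ ⊆ I·gJ, and I·gJ already lies in the
    -- component at stage q.
    refine (le_inf h1 h2).trans (hgF.trans ?_)
    rw [hp q hpq]
    exact mul_smul_extComponent_le g

/-- The exceptional cosets are those meeting the supports of finitely many generators of ⊕ (I ∩
P^g)g. -/
theorem exists_cosetUnion_of_isNoetherianRing (hI : I.IsPrime)
    [hR : IsNoetherianRing (skewIdealizer G I)] (P : Ideal C) :
    ∃ F, ∀ g ∉ cosetUnion (MulAction.stabilizer G I) F, I ⊓ g • P ≤ I * g • P := by
  classical
  have hco : ∀ (r a : SkewMonoidAlgebra C G) (g : G) (T : Ideal C),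
      (∀ h, r.coeff h * h • a.coeff (h⁻¹ * g) ∈ T) → (r * a).coeff g ∈ T := fun r a g T hT => by
    rw [coeff_mul_left, sum_def']
    exact T.sum_mem fun h _ => hT h
  have hadd : ∀ (a b : SkewMonoidAlgebra C G) (g : G) (T : Ideal C),
      a.coeff g ∈ T → b.coeff g ∈ T → (a + b).coeff g ∈ T := fun a b g T ha hb => by
    rw [coeff_add, Finsupp.add_apply]
    exact T.add_mem ha hb
  have hsm : ∀ (g h : G) (c : C), c ∈ (h⁻¹ * g) • P → h • c ∈ g • P := fun g h c hc => by
    have := Ideal.smul_mem_pointwise_smul h _ _ hc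
    rwa [← mul_smul, mul_inv_cancel_left] at this
  let L : Submodule (skewIdealizer G I) (skewIdealizer G I) :=
    { carrier := {a | ∀ g, a.1.coeff g ∈ I ⊓ g • P}
      zero_mem' := fun g => zero_mem _
      add_mem' := fun ha hb g => hadd _ _ _ _ (ha g) (hb g)
      smul_mem' := fun r a ha g => hco _ _ _ _ fun h =>
        ⟨coeff_mem_colonAct r.2 h _ (ha _).1, Ideal.mul_mem_left _ _ (hsm g h _ (ha _).2)⟩ }
  obtain ⟨s, hs⟩ := hR.noetherian L
  let F := s.biUnion fun a => a.1.support
  refine ⟨F, fun g hg x hx => ?_⟩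
  -- D is a left ideal for two reasons: degrees h in the stabiliser preserve I and the right cosets,
  -- while for other h the coefficients lie in I and supply the factor I themselves. The generators
  -- lie in D because they vanish off the exceptional cosets.
  let D : Submodule (skewIdealizer G I) (skewIdealizer G I) :=
    { carrier := {a | ∀ g, a.1.coeff g ∈ g • P ∧
        (g ∉ cosetUnion (MulAction.stabilizer G I) F → a.1.coeff g ∈ I * g • P)}
      zero_mem' := fun g => ⟨zero_mem _, fun _ => zero_mem _⟩
      add_mem' := fun ha hb g => ⟨hadd _ _ _ _ (ha g).1 (hb g).1,
        fun hg => hadd _ _ _ _ ((ha g).2 hg) ((hb g).2 hg)⟩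
      smul_mem' := fun r a ha g =>
        ⟨hco _ _ _ _ fun h => Ideal.mul_mem_left _ _ (hsm g h _ (ha _).1),
          fun hg => hco _ _ _ _ fun h => by
            by_cases hh : h ∈ MulAction.stabilizer G I
            · refine Ideal.mul_mem_left _ _ ?_
              have h1 := Ideal.smul_mem_pointwise_smul h _ _ ((ha (h⁻¹ * g)).2
                (by rwa [mul_mem_cosetUnion (inv_mem hh)]))
              rwa [smul_mul', MulAction.mem_stabilizer_iff.1 hh, ← mul_smul,
                mul_inv_cancel_left] at h1
            · exact Ideal.mul_mem_mul (mem_of_mem_colonAct hI hh (coeff_mem_colonAct r.2 h))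
                (hsm g h _ (ha _).1)⟩ }
  have hLD : L ≤ D := by
    rw [← hs, Submodule.span_le]
    intro a ha g
    have haL : a ∈ L := hs ▸ Submodule.subset_span ha
    refine ⟨(haL g).2, fun hg => ?_⟩
    have : a.1.coeff g = 0 := by
      by_contra h0
      exact hg (subset_cosetUnion _ F (Finset.mem_biUnion.2 ⟨a, ha, mem_support_iff.2 h0⟩))
    rw [this]
    exact zero_mem _
  have hxL : homog I g ⟨x, le_colonAct I g hx.1⟩ ∈ L := fun y => by
    change (single g x).coeff y ∈ _
    rw [coeff_single_apply]
    split_ifs with h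
    · exact h ▸ hx
    · exact zero_mem _
  have := (hLD hxL g).2 hg
  change (single g x).coeff g ∈ _ at this
  rwa [coeff_single_apply, if_pos rfl] at this

end Idealizer

end

noncomputable section

/-! ### Finite generation of the sum of Tor modules. -/

section TorSum

variable {C : Type*} [CommRing C] {G : Type*} [Group G] [MulSemiringAction G C]

/-- The coefficient of degree `g` of an element of the direct sum of torsion modules. -/
def TorSum.coeff (I P : Ideal C) (g : G) : TorSum G I P →+ Tor₁ C (C ⧸ I) (C ⧸ g • P) :=
  DFinsupp.evalAddMonoidHom (β := fun g : G => Tor₁ C (C ⧸ I) (C ⧸ g • P)) g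

variable {I P : Ideal C}

theorem TorSum.coeff_of_same (g : G) (x : Tor₁ C (C ⧸ I) (C ⧸ g • P)) :
    TorSum.coeff I P g (TorSum.of I P g x) = x := by
  classical
  exact DirectSum.of_eq_same (β := fun g : G => Tor₁ C (C ⧸ I) (C ⧸ g • P)) g x

theorem TorSum.coeff_of_ne {g g' : G} (h : g ≠ g') (x : Tor₁ C (C ⧸ I) (C ⧸ g • P)) :
    TorSum.coeff I P g' (TorSum.of I P g x) = 0 := by
  classical
  exact DirectSum.of_eq_of_ne (β := fun g : G => Tor₁ C (C ⧸ I) (C ⧸ g • P)) g g' x h.symm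

theorem TorSum.induction {p : TorSum G I P → Prop} (zero : p 0)
    (add : ∀ x y, p x → p y → p (x + y)) (of : ∀ g x, p (TorSum.of I P g x))
    (x : TorSum G I P) : p x := by
  classical
  exact DirectSum.induction_on (motive := p) x zero of add

theorem TorSum.exists_finset (x : TorSum G I P) :
    ∃ F : Finset G, ∀ g ∉ F, TorSum.coeff I P g x = 0 := by
  classical
  induction x using TorSum.induction with
  | zero => exact ⟨∅, fun g _ => map_zero _⟩
  | add x y hx hy =>
    obtain ⟨F, hF⟩ := hx
    obtain ⟨F', hF'⟩ := hy
    refine ⟨F ∪ F', fun g hg => ?_⟩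
    rw [Finset.mem_union, not_or] at hg
    rw [map_add, hF g hg.1, hF' g hg.2, add_zero]
  | of g x =>
    refine ⟨{g}, fun g' hg' => TorSum.coeff_of_ne ?_ x⟩
    rintro rfl
    exact hg' (Finset.mem_singleton_self _)

theorem TorSum.coeff_homog_smul (h : G) (c : colonAct I h) {g g' : G} (hg : h * g = g')
    (x : TorSum G I P) :
    TorSum.coeff I P g' (homog I h c • x) = torShift I P h c hg (TorSum.coeff I P g x) := by
  subst hg
  change TorSum.coeff I P (h * g) (torActHom I P (homog I h c) x) = _
  rw [torActHom_homog]
  induction x using TorSum.induction with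
  | zero =>
    rw [(TorSum.coeff I P g).map_zero, (torShift I P h c _).map_zero,
      map_zero (homogAct I P h c), (TorSum.coeff I P (h * g)).map_zero]
  | add x y hx hy =>
    refine ((congrArg _ (map_add (homogAct I P h c) x y)).trans (map_add _ _ _)).trans ?_
    refine (congrArg₂ (· + ·) hx hy).trans ?_
    exact ((congrArg _ (map_add (TorSum.coeff I P g) x y)).trans (map_add _ _ _)).symm
  | of k x =>
    refine (congrArg _ (homogAct_of I P h c k x)).trans ?_
    by_cases hk : k = g
    · subst hk
      exact (TorSum.coeff_of_same _ _).trans (congrArg _ (TorSum.coeff_of_same _ _).symm)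
    · refine (TorSum.coeff_of_ne (fun h' => hk (mul_left_cancel h')) _).trans ?_
      exact ((congrArg _ (TorSum.coeff_of_ne hk x)).trans (map_zero _)).symm

/-- Multiplication by c already vanishes on C/I. -/
theorem torShift_eq_zero {h : G} {c : colonAct I h} (hc : c.1 ∈ I) {g g' : G} (hg : h * g = g')
    (x : Tor₁ C (C ⧸ I) (C ⧸ g • P)) : torShift I P h c hg x = 0 := by
  have h0 : quotMul I h c = 0 := LinearMap.ext fun m => by
    obtain ⟨m, rfl⟩ := Submodule.Quotient.mk_surjective _ m
    exact (Submodule.Quotient.mk_eq_zero _).2 (I.mul_mem_right _ hc)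
  ext1
  change TensorProduct.map (quotMul I h c) _ x.1 = 0
  rw [h0, TensorProduct.map_zero_left, LinearMap.zero_apply]

theorem torShift_one_eq_smul (c : C) (hc : c ∈ colonAct I (1 : G)) {g : G} (hg : 1 * g = g)
    (x : Tor₁ C (C ⧸ I) (C ⧸ g • P)) : torShift I P 1 ⟨c, hc⟩ hg x = c • x := by
  ext1
  change TensorProduct.map _ _ x.1 = c • x.1
  induction x.1 using TensorProduct.induction_on with
  | zero => simp
  | add x y hx hy => simp only [map_add, smul_add, hx, hy]
  | tmul m n =>
    rw [TensorProduct.map_tmul, TensorProduct.smul_tmul']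
    congr 1
    · obtain ⟨m, rfl⟩ := Submodule.Quotient.mk_surjective _ m
      change Submodule.Quotient.mk _ = Submodule.Quotient.mk _
      congr 1
      change c * (1 : G) • m = c • m
      rw [one_smul, smul_eq_mul]
    · refine relMap_id _ (fun a => one_smul G a) (fun n => ?_) n
      obtain ⟨n, rfl⟩ := Submodule.Quotient.mk_surjective _ n
      change Submodule.Quotient.mk _ = Submodule.Quotient.mk _
      congr 1
      exact one_smul G n

variable [IsNoetherianRing C]

/-- Only degrees in the stabiliser act nontrivially, so the elements supported on a union of its
right cosets form a submodule. Take the cosets met by finitely many generators. -/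
theorem exists_cosetUnion_of_finite_torSum (hI : I.IsPrime)
    [hfin : Module.Finite (skewIdealizer G I) (TorSum G I P)] :
    ∃ F, ∀ g ∉ cosetUnion (MulAction.stabilizer G I) F,
      Subsingleton (Tor₁ C (C ⧸ I) (C ⧸ g • P)) := by
  classical
  obtain ⟨s, hs⟩ := hfin
  choose F hF using TorSum.exists_finset (I := I) (P := P) (G := G)
  let D : Submodule (skewIdealizer G I) (TorSum G I P) :=
    { carrier := {x | ∀ g ∉ cosetUnion (MulAction.stabilizer G I) (s.biUnion F),
        TorSum.coeff I P g x = 0}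
      zero_mem' := fun g _ => map_zero _
      add_mem' := fun {x y} hx hy g hg => by rw [map_add, hx g hg, hy g hg, add_zero]
      smul_mem' := fun r x hx g hg => by
        induction r using skewIdealizer_induction with
        | zero => rw [zero_smul, map_zero]
        | add r r' hr hr' => rw [add_smul, map_add, hr, hr', add_zero]
        | single h c =>
          rw [TorSum.coeff_homog_smul h c (mul_inv_cancel_left h g)]
          by_cases hh : h ∈ MulAction.stabilizer G I
          · rw [hx, map_zero]
            rwa [mul_mem_cosetUnion (inv_mem hh)]
          · exact torShift_eq_zero (mem_of_mem_colonAct hI hh c.2) _ _ }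
  have hD : D = ⊤ := by
    rw [eq_top_iff, ← hs, Submodule.span_le]
    exact fun x hx g hg => hF x g fun h =>
      hg (subset_cosetUnion _ _ (Finset.mem_biUnion.2 ⟨x, hx, h⟩))
  refine ⟨s.biUnion F, fun g hg => subsingleton_of_forall_eq 0 fun x => ?_⟩
  have hx : TorSum.of I P g x ∈ D := hD ▸ Submodule.mem_top
  rw [← TorSum.coeff_of_same g x]
  exact hx g hg

/-- Generators over C of the finitely many modules in degrees f ∈ F suffice: the stabiliser carries
degree f bijectively onto every degree of its coset, and all other degrees are zero. -/
theorem finite_torSum_of_cosetUnion (F : Finset G)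
    (hF : ∀ g ∉ cosetUnion (MulAction.stabilizer G I) F,
      Subsingleton (Tor₁ C (C ⧸ I) (C ⧸ g • P))) :
    Module.Finite (skewIdealizer G I) (TorSum G I P) := by
  classical
  choose T hT using fun g : G =>
    (finite_tor₁ (C ⧸ I) (g • P : Ideal C)).fg_top
  refine ⟨F.biUnion fun f => (T f).image (TorSum.of I P f), eq_top_iff.2 fun x _ => ?_⟩
  set D := Submodule.span (skewIdealizer G I)
    ((F.biUnion fun f => (T f).image (TorSum.of I P f) : Finset (TorSum G I P)) :
      Set (TorSum G I P)) with hD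
  have key : ∀ f ∈ F, ∀ y : Tor₁ C (C ⧸ I) (C ⧸ f • P), TorSum.of I P f y ∈ D := by
    intro f hf y
    have hy : y ∈ Submodule.span C (T f : Set (Tor₁ C (C ⧸ I) (C ⧸ f • P))) :=
      hT f ▸ Submodule.mem_top
    induction hy using Submodule.span_induction with
    | mem y hy =>
      exact Submodule.subset_span (Finset.mem_biUnion.2 ⟨f, hf, Finset.mem_image_of_mem _ hy⟩)
    | zero => rw [map_zero]; exact D.zero_mem
    | add y z _ _ hy hz => rw [map_add]; exact D.add_mem hy hz
    | smul c y _ hy =>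
      -- The C-action on each Tor is the action of the degree 1 part of the idealiser.
      have hc : c ∈ colonAct I (1 : G) := fun i hi => I.mul_mem_left c (by rwa [one_smul])
      rw [← torShift_one_eq_smul c hc (one_mul f), ← of_torShift, ← homog_smul_of]
      exact D.smul_mem _ hy
  induction x using TorSum.induction with
  | zero => exact D.zero_mem
  | add x y hx hy => exact D.add_mem (hx trivial) (hy trivial)
  | of g x =>
    by_cases hg : g ∈ cosetUnion (MulAction.stabilizer G I) F
    · obtain ⟨f, hf, hs⟩ := hg
      set s := g * f⁻¹ with hsdef
      have hsf : s * f = g := by rw [hsdef, inv_mul_cancel_right]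
      have hsg : s⁻¹ * g = f := by rw [← hsf, inv_mul_cancel_left]
      have h1 : (1 : C) ∈ colonAct I (s * s⁻¹) := by
        rw [mul_inv_cancel]
        exact one_mem_colonAct (one_mem _)
      have hx : torShift I P s ⟨1, one_mem_colonAct hs⟩ hsf
          (torShift I P s⁻¹ ⟨1, one_mem_colonAct (inv_mem hs)⟩ hsg x) = x := by
        have hg1 : s * s⁻¹ * g = g := by rw [mul_inv_cancel, one_mul]
        rw [torShift_mul I P s s⁻¹ _ _ ⟨1, h1⟩ (by simp) hsg hsf hg1]
        -- The degree s * s⁻¹ occurs in the types, so it is generalised to t before being replaced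
        -- by 1.
        have aux : ∀ (t : G) (ht : t = 1) (h : 1 ∈ colonAct I t) (hg : t * g = g),
            torShift I P t ⟨1, h⟩ hg x = x := by
          rintro t rfl h hg
          exact torShift_one I P _ rfl hg x
        exact aux _ (mul_inv_cancel s) h1 hg1
      rw [← hx, ← of_torShift, ← homog_smul_of]
      exact D.smul_mem _ (key f hf _)
    · have := hF g hg
      rw [Subsingleton.elim x 0, map_zero]
      exact D.zero_mem

end TorSum

end

theorem mainTheorem10
    {𝕜 : Type*} [Field 𝕜] [IsAlgClosed 𝕜]
    {C : Type*} [CommRing C] [IsDomain C] [IsNoetherianRing C] [Algebra 𝕜 C]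
    {G : Type*} [Group G] (hG : IsPolycyclicByFinite G) [MulSemiringAction G C]
    (I : Ideal C) (hI : I.IsPrime) :
    IsNoetherianRing (skewIdealizer G I) ↔
      ∀ P : Ideal C, P.IsPrime → Module.Finite (skewIdealizer G I) (TorSum G I P) := by
  constructor
  · intro hR P _
    obtain ⟨F, hF⟩ := exists_cosetUnion_of_isNoetherianRing (G := G) hI P
    exact finite_torSum_of_cosetUnion F fun g hg => (subsingleton_tor₁_iff _ _).2 (hF g hg)
  · intro h
    refine SkewMonoidAlgebra.isNoetherianRing_of_chainCondition (isGraded_skewIdealizer I) hG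
      (chainCondition_skewIdealizer hI fun P hP => ?_)
    have := h P hP
    obtain ⟨F, hF⟩ := exists_cosetUnion_of_finite_torSum (G := G) (P := P) hI
    exact ⟨F, fun g hg => (subsingleton_tor₁_iff _ _).1 (hF g hg)⟩
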